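/- Let $d\ge 1$ be an integer and let $s\in\mathbb{R}$ satisfy $s\le -\tfrac12$ if $d=1$, and $s<0$ if $d\ge 2$. Let $\mu\in\{1,-1\}$. Then the quintic fourth-order nonlinear Schrödinger equation $$ i\partial_t u+\Delta^2u+\mu|u|^4u=0 \qquad (x\in\mathbb{R}^d) $$ exhibits norm inflation at every $u_0\in H^s(\mathbb{R}^d)$. That is, for every $u_0\in H^s(\mathbb{R}^d)$ and every $\varepsilon>0$ there are $T>0$, a solution $u$ of the equation on $[0,T]$, and a time $t\in(0,\varepsilon)$ with $t\le T$, such that $$ \|u(0)-u_0\|_{H^s}<\varepsilon \qquad\text{and}\qquad \|u(t)\|_{H^s}>\varepsilon^{-1}. $$ Here $\|f\|_{H^s}=\|\langle\xi\rangle^s\hat f\|_{L^2}$ with $\langle\xi\rangle=(1+|\xi|^2)^{1/2}$, and $FL^1$ is the space of (bounded continuous) functions $f$ with $\|f\|_{FL^1}=\|\hat f\|_{L^1}<\infty$. A solution on $[0,T]$ is a function $u\in C([0,T],FL^1(\mathbb{R}^d))\cap C([0,T],H^s(\mathbb{R}^d))$ which is differentiable in time as a map into the tempered distributions (tested against each Schwartz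 function, one-sidedly at the end points) and satisfies the equation in the sense of tempered distributions at every $t\in[0,T]$. -/

import Mathlib

open MeasureTheory TemperedDistribution Set Filter Topology
open scoped SchwartzMap FourierTransform Laplacian ENNReal BoundedContinuousFunction

namespace QuinticFourthOrderNLS

/-- The Euclidean space `ℝ^d`. -/
abbrev Space (d : ℕ) : Type := EuclideanSpace ℝ (Fin d)

/-- The Fourier-Lebesgue norm `‖⟨ξ⟩^s 𝓕f‖_{L^p}` of a tempered distribution, where
`⟨ξ⟩ = (1 + |ξ|²)^(1/2)`. It is the `L^p` norm of the (unique) `L^p` function that represents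
`⟨ξ⟩^s 𝓕f`, and it is `⊤` if there is no such function. With Mathlib's convention for the Fourier
transform, `ξ` is the frequency of `exp (2πi⟨ξ, x⟩)`; other conventions give equivalent norms. -/
noncomputable def fourierLebesgueNorm {d : ℕ} (s : ℝ) (p : ℝ≥0∞) [Fact (1 ≤ p)]
    (f : 𝓢'(Space d, ℂ)) : ℝ≥0∞ :=
  ⨅ (g : Lp ℂ p (volume : Measure (Space d)))
    (_ : smulLeftCLM ℂ (fun ξ : Space d ↦ (((1 + ‖ξ‖ ^ 2) ^ (s / 2) : ℝ) : ℂ)) (𝓕 f) =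
      (g : 𝓢'(Space d, ℂ))), ‖g‖ₑ

/-- The norm of the Fourier-Lebesgue space `FL¹`. -/
noncomputable def fl1Norm {d : ℕ} (f : 𝓢'(Space d, ℂ)) : ℝ≥0∞ :=
  fourierLebesgueNorm 0 1 f

/-- The norm of the Sobolev space `H^s`, with value `⊤` outside `H^s`. The space `H^s` itself is
Mathlib's `TemperedDistribution.MemSobolev s 2`. -/
noncomputable def sobolevNorm {d : ℕ} (s : ℝ) (f : 𝓢'(Space d, ℂ)) : ℝ≥0∞ :=
  fourierLebesgueNorm s 2 f

/-- The tempered distribution `φ ↦ ∫ φ f` defined by a bounded continuous function `f`. -/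
noncomputable def toDistribution {d : ℕ} (f : Space d →ᵇ ℂ) : 𝓢'(Space d, ℂ) :=
  ((f.memLp_top (μ := volume)).toLp f : Lp ℂ ∞ (volume : Measure (Space d)))

/-- The quintic nonlinearity `|f|⁴ f`. -/
noncomputable def quintic {d : ℕ} (f : Space d →ᵇ ℂ) : Space d →ᵇ ℂ :=
  BoundedContinuousFunction.ofNormedAddCommGroup (fun x ↦ ((‖f x‖ ^ 4 : ℝ) : ℂ) * f x)
    (by fun_prop) (‖f‖ ^ 4 * ‖f‖) (fun x ↦ by
      have h := f.norm_coe_le_norm x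
      rw [norm_mul, Complex.norm_real, norm_pow, norm_norm]
      gcongr)

/-- `u ∈ C([0,T], X)`, where `X` consists of the distributions with finite norm `N`. -/
def ContinuousInNorm {d : ℕ} (N : 𝓢'(Space d, ℂ) → ℝ≥0∞) (T : ℝ) (u : ℝ → Space d →ᵇ ℂ) : Prop :=
  ∀ t ∈ Icc 0 T, N (toDistribution (u t)) < ∞ ∧
    Tendsto (fun τ ↦ N (toDistribution (u τ) - toDistribution (u t))) (𝓝[Icc 0 T] t) (𝓝 0)

/-- `u` is a solution on `[0,T]`, in `C([0,T], FL¹) ∩ C([0,T], H^s)`, of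
`i ∂ₜu + Δ²u + μ|u|⁴u = 0`. Elements of `FL¹` are bounded continuous functions. At every time the
equation holds in the space of tempered distributions, and `v` is the time derivative of `u`
there (one-sided at the end points). -/
structure IsSolution {d : ℕ} (μ s T : ℝ) (u : ℝ → Space d →ᵇ ℂ) : Prop where
  continuous_fl1 : ContinuousInNorm fl1Norm T u
  continuous_sobolev : ContinuousInNorm (sobolevNorm s) T u
  equation : ∀ t ∈ Icc 0 T, ∃ v : 𝓢'(Space d, ℂ),
    (∀ φ : 𝓢(Space d, ℂ),
      HasDerivWithinAt (fun τ ↦ toDistribution (u τ) φ) (v φ) (Icc 0 T) t) ∧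
    Complex.I • v + Δ (Δ (toDistribution (u t))) + (μ : ℂ) • toDistribution (quintic (u t)) = 0

/-- Norm inflation at `u₀` in `H^s`: for every `ε > 0` there are a (local in time) solution `u` and
a time `t ∈ (0,ε)` in its interval of existence such that `‖u(0) - u₀‖_{H^s} < ε` and
`‖u(t)‖_{H^s} > 1/ε`. -/
def NormInflationAt {d : ℕ} (μ s : ℝ) (u₀ : 𝓢'(Space d, ℂ)) : Prop :=
  ∀ ε : ℝ, 0 < ε → ∃ T : ℝ, 0 < T ∧ ∃ u : ℝ → Space d →ᵇ ℂ, IsSolution μ s T u ∧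
    sobolevNorm s (toDistribution (u 0) - u₀) < ENNReal.ofReal ε ∧
    ∃ t ∈ Ioo 0 ε, t ≤ T ∧ ENNReal.ofReal (1 / ε) < sobolevNorm s (toDistribution (u t))

end QuinticFourthOrderNLS

/-! The mechanism is a transfer from high to low frequencies. The data are ψ + φ, where ψ
approximates u₀ and has a continuous, compactly supported Fourier transform, and φ consists on the
Fourier side of two bumps of height R and radius A at η and 2η, with |η| = N. For negative s the
high frequencies are cheap in H^s, and φ can be made small there. In u ū u ū u the bumps interact
through η − 2η + η − 2η + 2η = 0, so with X = R A^d the first Picard iterate has size about T R X⁴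
on the ball |ξ| < A/2, where the weight ⟨ξ⟩^s costs much less.

The time is T = δ / N⁴. Then the phases exp(it(2π|ξ|)⁴) with |ξ| ≤ 3N differ from 1 by O(δ), and X ≤
N gives T X⁴ ≤ δ, so the problem is perturbative. Let w and b be the solutions with data ψ + φ and
ψ. By `norm_sub_sub_nonlin_le`, (w − b)(T) is φ + iμT·`nonlin φ` up to errors which, when ‖ψ‖ ≤ δX,
carry an extra factor δ; this and the lower bound `MinorizedOn.nonlin` give `exists_growth`. Since
b(T) is bounded by 2‖ψ‖, uniformly in N, the H^s norm of w(T) is at least κ (X/N)⁴ R √(`lowMass`) −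
2‖ψ‖.

Everything takes place in C₀ ∩ L¹ on the frequency side. The L¹ norm makes convolution an algebra,
and the supremum norm records heights: placing one factor in the supremum norm and four in L¹ gives
precisely the size R X⁴ of the main term. In the interaction picture the equation is an ODE with a
locally Lipschitz vector field, with no unbounded operator.

What remains is the choice of N, A, R (`normInflationAt_of_parameters`). Below the scaling exponent
d/2 − 1 powers of N suffice (`exists_parameters_of_lt`). At d = 1, s = −1/2 the powers balance, and
the logarithmic divergence of ∫⟨ξ⟩⁻¹ decides (`exists_parameters_critical`). -/

namespace QuinticFourthOrderNLS

open scoped ZeroAtInfty Convolution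

/-! ### The Banach space C₀ ∩ L¹ on the frequency side -/

/-- The pairs in `C₀ × L¹` whose components agree almost everywhere. -/
noncomputable def freqSubmodule (d : ℕ) :
    Submodule ℂ (C₀(Space d, ℂ) × Lp ℂ 1 (volume : Measure (Space d))) where
  carrier := {p | (p.2 : Space d → ℂ) =ᵐ[volume] p.1}
  add_mem' {p q} hp hq := by
    filter_upwards [hp, hq, Lp.coeFn_add p.2 q.2] with x h₁ h₂ h₃
    rw [Prod.snd_add, h₃, Pi.add_apply, h₁, h₂]; rfl
  zero_mem' := by
    filter_upwards [Lp.coeFn_zero ℂ 1 (volume : Measure (Space d))] with x h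
    exact h
  smul_mem' c p hp := by
    filter_upwards [hp, Lp.coeFn_smul c p.2] with x h₁ h₂
    rw [Prod.smul_snd, h₂, Pi.smul_apply, h₁]; rfl

/-- An L¹-convergent sequence has an almost everywhere convergent subsequence, whose limit must be
the uniform limit. This supplies the completeness needed for Picard-Lindelöf. -/
theorem isClosed_freqSubmodule (d : ℕ) :
    IsClosed (freqSubmodule d : Set (C₀(Space d, ℂ) × Lp ℂ 1 (volume : Measure (Space d)))) := by
  refine IsSeqClosed.isClosed fun p q hp hpq ↦ ?_
  have h₁ : Tendsto (fun n ↦ (p n).1) atTop (𝓝 q.1) := (continuous_fst.tendsto _).comp hpq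
  have h₂ : Tendsto (fun n ↦ (p n).2) atTop (𝓝 q.2) := (continuous_snd.tendsto _).comp hpq
  obtain ⟨ns, hns, hlim⟩ := (tendstoInMeasure_of_tendsto_Lp h₂).exists_seq_tendsto_ae
  have hall : ∀ᵐ x ∂(volume : Measure (Space d)), ∀ n, ((p n).2 : Space d → ℂ) x = (p n).1 x :=
    ae_all_iff.2 fun n ↦ hp n
  filter_upwards [hlim, hall] with x hx hx'
  simp only [hx'] at hx
  refine tendsto_nhds_unique hx ?_
  exact ((ZeroAtInftyContinuousMap.tendsto_iff_tendstoUniformly.1 h₁).tendsto_at x).comp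
    hns.tendsto_atTop

/-- The Banach space `C₀ ∩ L¹` of functions on the frequency space, with the larger of the two
norms. -/
def FreqSpace (d : ℕ) : Type := freqSubmodule d

namespace FreqSpace

variable {d : ℕ}

noncomputable instance : NormedAddCommGroup (FreqSpace d) :=
  inferInstanceAs (NormedAddCommGroup (freqSubmodule d))

noncomputable instance : NormedSpace ℂ (FreqSpace d) :=
  inferInstanceAs (NormedSpace ℂ (freqSubmodule d))

instance : CompleteSpace (FreqSpace d) := (isClosed_freqSubmodule d).completeSpace_coe

noncomputable instance : CoeFun (FreqSpace d) (fun _ ↦ Space d → ℂ) := ⟨fun f ↦ f.1.1⟩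

theorem coe_ae (f : FreqSpace d) : (f.1.2 : Space d → ℂ) =ᵐ[volume] f := f.2

theorem continuous_coe (f : FreqSpace d) : Continuous f := map_continuous f.1.1

theorem tendsto_zero (f : FreqSpace d) : Tendsto f (cocompact (Space d)) (𝓝 0) :=
  zero_at_infty f.1.1

theorem integrable (f : FreqSpace d) : Integrable f :=
  (L1.integrable_coeFn f.1.2).congr f.coe_ae

@[ext]
theorem ext {f g : FreqSpace d} (h : ∀ ξ, f ξ = g ξ) : f = g := by
  refine Subtype.ext (Prod.ext (ZeroAtInftyContinuousMap.ext h) (Lp.ext ?_))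
  filter_upwards [f.coe_ae, g.coe_ae] with ξ h₁ h₂
  rw [h₁, h₂, h]

/-- The element of `FreqSpace d` given by an integrable continuous function vanishing at infinity. -/
noncomputable def of (f : Space d → ℂ) (hc : Continuous f)
    (h₀ : Tendsto f (cocompact (Space d)) (𝓝 0)) (hi : Integrable f) : FreqSpace d :=
  ⟨(⟨⟨f, hc⟩, h₀⟩, hi.toL1 f), hi.coeFn_toL1⟩

@[simp] theorem add_apply (f g : FreqSpace d) (ξ : Space d) : (f + g) ξ = f ξ + g ξ := rfl
@[simp] theorem sub_apply (f g : FreqSpace d) (ξ : Space d) : (f - g) ξ = f ξ - g ξ := rfl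
@[simp] theorem smul_apply (c : ℂ) (f : FreqSpace d) (ξ : Space d) : (c • f) ξ = c * f ξ := rfl
@[simp] theorem zero_apply (ξ : Space d) : (0 : FreqSpace d) ξ = 0 := rfl

/-- The projection of `C₀ ∩ L¹` to `C₀`. -/
noncomputable def toC0 : FreqSpace d →L[ℂ] C₀(Space d, ℂ) :=
  (ContinuousLinearMap.fst ℂ _ _).comp (freqSubmodule d).subtypeL

/-- The projection of `C₀ ∩ L¹` to `L¹`. -/
noncomputable def toL1 : FreqSpace d →L[ℂ] Lp ℂ 1 (volume : Measure (Space d)) :=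
  (ContinuousLinearMap.snd ℂ _ _).comp (freqSubmodule d).subtypeL

/-- The supremum norm. -/
noncomputable def supNorm (f : FreqSpace d) : ℝ := ‖toC0 f‖

/-- The `L¹` norm. -/
noncomputable def l1Norm (f : FreqSpace d) : ℝ := ‖toL1 f‖

theorem norm_eq (f : FreqSpace d) : ‖f‖ = max f.supNorm f.l1Norm := rfl

theorem supNorm_le_norm (f : FreqSpace d) : f.supNorm ≤ ‖f‖ := le_max_left _ _

theorem l1Norm_le_norm (f : FreqSpace d) : f.l1Norm ≤ ‖f‖ := le_max_right _ _

theorem supNorm_nonneg (f : FreqSpace d) : 0 ≤ f.supNorm := norm_nonneg _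

theorem l1Norm_nonneg (f : FreqSpace d) : 0 ≤ f.l1Norm := norm_nonneg _

theorem l1Norm_eq (f : FreqSpace d) : f.l1Norm = ∫ ξ, ‖f ξ‖ := by
  rw [l1Norm, L1.norm_eq_integral_norm]
  refine integral_congr_ae ?_
  filter_upwards [f.coe_ae] with ξ h
  exact congrArg norm h

theorem norm_apply_le (f : FreqSpace d) (ξ : Space d) : ‖f ξ‖ ≤ f.supNorm :=
  f.1.1.toBCF.norm_coe_le_norm ξ

theorem supNorm_le {f : FreqSpace d} {C : ℝ} (hC : 0 ≤ C) (h : ∀ ξ, ‖f ξ‖ ≤ C) : f.supNorm ≤ C :=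
  (BoundedContinuousFunction.norm_le (f := f.1.1.toBCF) hC).2 h

theorem supNorm_add_le (f g : FreqSpace d) : (f + g).supNorm ≤ f.supNorm + g.supNorm :=
  norm_add_le (toC0 f) (toC0 g)

theorem l1Norm_add_le (f g : FreqSpace d) : (f + g).l1Norm ≤ f.l1Norm + g.l1Norm :=
  norm_add_le (toL1 f) (toL1 g)

theorem supNorm_smul (c : ℂ) (f : FreqSpace d) : (c • f).supNorm = ‖c‖ * f.supNorm := by
  rw [supNorm, map_smul, norm_smul, supNorm]

theorem l1Norm_smul (c : ℂ) (f : FreqSpace d) : (c • f).l1Norm = ‖c‖ * f.l1Norm := by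
  rw [l1Norm, map_smul, norm_smul, l1Norm]

theorem l1Norm_le_of_norm_le {f g : FreqSpace d} {C : ℝ} (h : ∀ ξ, ‖f ξ‖ ≤ C * ‖g ξ‖) :
    f.l1Norm ≤ C * g.l1Norm := by
  rw [l1Norm_eq, l1Norm_eq, ← integral_const_mul]
  exact integral_mono f.integrable.norm (g.integrable.norm.const_mul C) h

/-- Evaluation at a frequency. -/
noncomputable def evalCLM (ξ : Space d) : FreqSpace d →L[ℂ] ℂ :=
  LinearMap.mkContinuous ⟨⟨fun f ↦ f ξ, fun _ _ ↦ rfl⟩, fun _ _ ↦ rfl⟩ 1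
    fun f ↦ by rw [one_mul]; exact (f.norm_apply_le ξ).trans f.supNorm_le_norm

@[simp] theorem evalCLM_apply (ξ : Space d) (f : FreqSpace d) : evalCLM ξ f = f ξ := rfl

/-! ### The free evolution -/

/-- The symbol `(2π|ξ|)⁴` of `Δ²`. -/
noncomputable def symbol (ξ : Space d) : ℝ := (2 * Real.pi * ‖ξ‖) ^ 4

theorem symbol_nonneg (ξ : Space d) : 0 ≤ symbol ξ := by unfold symbol; positivity

theorem continuous_symbol : Continuous (symbol (d := d)) := by unfold symbol; fun_prop

/-- The phase `exp (it(2π|ξ|)⁴)`. -/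
noncomputable def phase (t : ℝ) (ξ : Space d) : ℂ := Complex.exp ((t * symbol ξ : ℝ) * Complex.I)

@[simp]
theorem norm_phase (t : ℝ) (ξ : Space d) : ‖phase t ξ‖ = 1 := Complex.norm_exp_ofReal_mul_I _

theorem continuous_phase (t : ℝ) : Continuous (phase (d := d) t) := by
  unfold phase; have := continuous_symbol (d := d); fun_prop

@[simp]
theorem phase_zero (ξ : Space d) : phase 0 ξ = 1 := by simp [phase]

theorem phase_add (t r : ℝ) (ξ : Space d) : phase (t + r) ξ = phase t ξ * phase r ξ := by
  rw [phase, phase, phase, ← Complex.exp_add]; push_cast; ring_nf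

theorem norm_phase_sub_le (t r : ℝ) (ξ : Space d) :
    ‖phase t ξ - phase r ξ‖ ≤ |t - r| * symbol ξ := by
  have h : phase t ξ - phase r ξ = phase r ξ * (phase (t - r) ξ - 1) := by
    rw [mul_sub, ← phase_add]; simp
  rw [h, norm_mul, norm_phase, one_mul, phase, mul_comm _ Complex.I]
  refine (Real.norm_exp_I_mul_ofReal_sub_one_le (x := (t - r) * symbol ξ)).trans ?_
  rw [Real.norm_eq_abs, abs_mul, abs_of_nonneg (symbol_nonneg ξ)]

theorem norm_phase_sub_one_le (t : ℝ) (ξ : Space d) :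
    ‖phase t ξ - 1‖ ≤ |t| * symbol ξ := by
  simpa using norm_phase_sub_le t 0 ξ

/-- The free evolution on the frequency side: multiplication by the phase. -/
noncomputable def evol (t : ℝ) (f : FreqSpace d) : FreqSpace d :=
  of (fun ξ ↦ phase t ξ * f ξ) ((continuous_phase t).mul f.continuous_coe)
    (by
      rw [tendsto_zero_iff_norm_tendsto_zero]
      simpa using f.tendsto_zero.norm)
    (f.integrable.bdd_mul (c := 1) (continuous_phase t).aestronglyMeasurable (by simp))

@[simp]
theorem evol_apply (t : ℝ) (f : FreqSpace d) (ξ : Space d) : evol t f ξ = phase t ξ * f ξ := rfl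

theorem evol_sub (t : ℝ) (f g : FreqSpace d) : evol t (f - g) = evol t f - evol t g := by
  ext ξ; simp [mul_sub]

@[simp]
theorem evol_zero (f : FreqSpace d) : evol 0 f = f := by ext ξ; simp

@[simp]
theorem l1Norm_evol (t : ℝ) (f : FreqSpace d) : (evol t f).l1Norm = f.l1Norm := by
  simp [l1Norm_eq]

@[simp]
theorem supNorm_evol (t : ℝ) (f : FreqSpace d) : (evol t f).supNorm = f.supNorm := by
  refine le_antisymm (supNorm_le f.supNorm_nonneg fun ξ ↦ by simpa using f.norm_apply_le ξ)
    (supNorm_le (evol t f).supNorm_nonneg fun ξ ↦ by simpa using (evol t f).norm_apply_le ξ)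

@[simp]
theorem norm_evol (t : ℝ) (f : FreqSpace d) : ‖evol t f‖ = ‖f‖ := by simp [norm_eq]

/-- Dominated convergence along a filter needs countable generation; it is used at infinity in
`tendsto_zero_conv`. -/
instance : (cocompact (Space d)).IsCountablyGenerated := by
  rw [← Metric.cobounded_eq_cocompact, ← comap_norm_atTop]; infer_instance

theorem tendsto_l1Norm_evol_sub (f : FreqSpace d) (t : ℝ) :
    Tendsto (fun r ↦ (evol r f - evol t f).l1Norm) (𝓝 t) (𝓝 0) := by
  simp only [l1Norm_eq]
  have h0 : (0 : ℝ) = ∫ ξ : Space d, (0 : ℝ) := by simp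
  rw [h0]
  refine tendsto_integral_filter_of_dominated_convergence (fun ξ ↦ 2 * ‖f ξ‖)
    (Eventually.of_forall fun r ↦
      (evol r f - evol t f).continuous_coe.norm.aestronglyMeasurable)
    (Eventually.of_forall fun r ↦ Eventually.of_forall fun ξ ↦ ?_) (f.integrable.norm.const_mul 2)
    (Eventually.of_forall fun ξ ↦ ?_)
  · rw [norm_norm, sub_apply, two_mul]
    exact (norm_sub_le _ _).trans (by simp)
  · have : Continuous fun r : ℝ ↦ ‖(evol r f - evol t f) ξ‖ := by
      simp only [sub_apply, evol_apply, phase]; fun_prop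
    simpa using this.tendsto t

/-- The phases converge only locally uniformly, so decay of f at infinity is essential: outside a
compact set f is small, and on it the symbol is bounded. -/
theorem tendsto_supNorm_evol_sub (f : FreqSpace d) (t : ℝ) :
    Tendsto (fun r ↦ (evol r f - evol t f).supNorm) (𝓝 t) (𝓝 0) := by
  rw [Metric.tendsto_nhds]
  intro ε hε
  have hs : ∀ᶠ ξ in cocompact (Space d), ‖f ξ‖ < ε / 4 := by
    simpa using (Metric.tendsto_nhds.1 f.tendsto_zero) (ε / 4) (by positivity)
  obtain ⟨K, hK, hKs⟩ := mem_cocompact.1 hs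
  obtain ⟨B, hB⟩ := (hK.image (continuous_symbol (d := d))).bddAbove
  have hB' : ∀ ξ ∈ K, symbol ξ ≤ max B 0 := fun ξ hξ ↦ (hB ⟨ξ, hξ, rfl⟩).trans (le_max_left _ _)
  have hlim : Tendsto (fun r ↦ |r - t| * max B 0 * f.supNorm) (𝓝 t) (𝓝 0) := by
    have : Continuous fun r : ℝ ↦ |r - t| * max B 0 * f.supNorm := by fun_prop
    simpa using this.tendsto t
  filter_upwards [(Metric.tendsto_nhds.1 hlim) (ε / 2) (by positivity)] with r hr
  have hr' : |r - t| * max B 0 * f.supNorm < ε / 2 := by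
    rw [Real.dist_0_eq_abs] at hr; exact (abs_lt.1 hr).2
  have hle : (evol r f - evol t f).supNorm ≤ ε / 2 := by
    refine supNorm_le (by positivity) fun ξ ↦ ?_
    rw [sub_apply, evol_apply, evol_apply, ← sub_mul, norm_mul]
    by_cases hξ : ξ ∈ K
    · refine le_trans ?_ hr'.le
      refine mul_le_mul ((norm_phase_sub_le r t ξ).trans ?_) (f.norm_apply_le ξ) (norm_nonneg _)
        (by positivity)
      gcongr; exact hB' ξ hξ
    · have h1 : ‖f ξ‖ < ε / 4 := hKs hξ
      have h2 : ‖phase r ξ - phase t ξ‖ ≤ 2 := (norm_sub_le _ _).trans (by simp; norm_num)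
      nlinarith [norm_nonneg (f ξ)]
  rw [Real.dist_0_eq_abs, abs_of_nonneg (supNorm_nonneg _)]
  linarith

theorem continuous_evol (f : FreqSpace d) : Continuous fun t ↦ evol t f := by
  rw [continuous_iff_continuousAt]
  intro t
  rw [ContinuousAt, tendsto_iff_norm_sub_tendsto_zero]
  simp only [norm_eq]
  simpa using (tendsto_supNorm_evol_sub f t).max (tendsto_l1Norm_evol_sub f t)

/-- The evolution is strongly continuous and isometric, but not norm continuous in time. The
isometry handles the variation of z, strong continuity that of the time. -/
theorem _root_.ContinuousOn.evol {s : Set ℝ} {g : ℝ → ℝ} {z : ℝ → FreqSpace d}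
    (hg : ContinuousOn g s) (hz : ContinuousOn z s) : ContinuousOn (fun t ↦ evol (g t) (z t)) s := by
  intro t ht
  rw [ContinuousWithinAt, tendsto_iff_norm_sub_tendsto_zero]
  have h₁ : Tendsto (fun r ↦ ‖z r - z t‖) (𝓝[s] t) (𝓝 0) :=
    tendsto_iff_norm_sub_tendsto_zero.1 (hz t ht)
  have h₂ : Tendsto (fun r ↦ ‖FreqSpace.evol (g r) (z t) - FreqSpace.evol (g t) (z t)‖)
      (𝓝[s] t) (𝓝 0) :=
    (tendsto_iff_norm_sub_tendsto_zero.1 ((continuous_evol (z t)).tendsto (g t))).comp (hg t ht)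
  refine squeeze_zero (fun _ ↦ norm_nonneg _) (fun r ↦ ?_) (by simpa using h₁.add h₂)
  calc _ = ‖FreqSpace.evol (g r) (z r - z t)
        + (FreqSpace.evol (g r) (z t) - FreqSpace.evol (g t) (z t))‖ := by
          rw [evol_sub]; congr 1; abel
    _ ≤ _ := (norm_add_le _ _).trans (by simp)


/-! ### Convolution -/

theorem integrable_conv_integrand (f g : FreqSpace d) (ξ : Space d) :
    Integrable fun η ↦ f η * g (ξ - η) :=
  f.integrable.mul_bdd (c := g.supNorm)
    (g.continuous_coe.comp (by fun_prop)).aestronglyMeasurable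
    (Eventually.of_forall fun η ↦ g.norm_apply_le _)

theorem tendsto_zero_conv (f g : FreqSpace d) :
    Tendsto (fun ξ ↦ ∫ η, f η * g (ξ - η)) (cocompact (Space d)) (𝓝 0) := by
  have h0 : (0 : ℂ) = ∫ _ : Space d, (0 : ℂ) := by simp
  rw [h0]
  refine tendsto_integral_filter_of_dominated_convergence (fun η ↦ ‖f η‖ * g.supNorm)
    (Eventually.of_forall fun ξ ↦ (f.integrable_conv_integrand g ξ).aestronglyMeasurable)
    (Eventually.of_forall fun ξ ↦ Eventually.of_forall fun η ↦ ?_) (f.integrable.norm.mul_const _)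
    (Eventually.of_forall fun η ↦ ?_)
  · rw [norm_mul]
    gcongr
    exact g.norm_apply_le _
  · have h : Tendsto (fun ξ : Space d ↦ ξ - η) (cocompact (Space d)) (cocompact (Space d)) :=
      (Homeomorph.subRight η).isClosedEmbedding.tendsto_cocompact
    simpa using (g.tendsto_zero.comp h).const_mul (f η)

/-- The convolution of two elements of `C₀ ∩ L¹`. -/
noncomputable def conv (f g : FreqSpace d) : FreqSpace d :=
  of (fun ξ ↦ ∫ η, f η * g (ξ - η))
    (BddAbove.continuous_convolution_right_of_integrable (ContinuousLinearMap.mul ℂ ℂ)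
      ⟨g.supNorm, by rintro _ ⟨ξ, rfl⟩; exact g.norm_apply_le ξ⟩ f.integrable g.continuous_coe)
    (tendsto_zero_conv f g)
    (f.integrable.integrable_convolution (ContinuousLinearMap.mul ℂ ℂ) g.integrable)

theorem conv_apply (f g : FreqSpace d) (ξ : Space d) : conv f g ξ = ∫ η, f η * g (ξ - η) := rfl

theorem coe_conv (f g : FreqSpace d) :
    (conv f g : Space d → ℂ) = f ⋆[ContinuousLinearMap.mul ℂ ℂ, volume] g := rfl

theorem conv_comm (f g : FreqSpace d) : conv f g = conv g f := by
  ext ξ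
  rw [conv_apply, conv_apply, ← integral_sub_left_eq_self _ volume ξ]
  simp [mul_comm]

theorem conv_add_right (f g h : FreqSpace d) : conv f (g + h) = conv f g + conv f h := by
  ext ξ
  simp only [conv_apply, add_apply, mul_add]
  exact integral_add (f.integrable_conv_integrand g ξ) (f.integrable_conv_integrand h ξ)

theorem conv_add_left (f g h : FreqSpace d) : conv (f + g) h = conv f h + conv g h := by
  rw [conv_comm, conv_add_right, conv_comm h, conv_comm h]

theorem supNorm_conv_le_right (f g : FreqSpace d) :
    (conv f g).supNorm ≤ f.l1Norm * g.supNorm := by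
  refine supNorm_le (mul_nonneg f.l1Norm_nonneg g.supNorm_nonneg) fun ξ ↦ ?_
  rw [conv_apply, l1Norm_eq, ← integral_mul_const]
  refine norm_integral_le_of_norm_le (f.integrable.norm.mul_const _) (Eventually.of_forall fun η ↦ ?_)
  rw [norm_mul]
  gcongr
  exact g.norm_apply_le _

theorem supNorm_conv_le_left (f g : FreqSpace d) :
    (conv f g).supNorm ≤ f.supNorm * g.l1Norm := by
  rw [conv_comm, mul_comm]; exact supNorm_conv_le_right g f

theorem l1Norm_conv_le (f g : FreqSpace d) : (conv f g).l1Norm ≤ f.l1Norm * g.l1Norm := by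
  have hint := f.integrable.norm.convolution_integrand (ContinuousLinearMap.mul ℝ ℝ)
    g.integrable.norm
  simp only [l1Norm_eq]
  have h := integral_convolution (ContinuousLinearMap.mul ℝ ℝ) f.integrable.norm g.integrable.norm
    (μ := volume) (ν := volume)
  simp only [ContinuousLinearMap.mul_apply'] at h
  rw [← h]
  refine integral_mono (conv f g).integrable.norm (f.integrable.norm.integrable_convolution
    (ContinuousLinearMap.mul ℝ ℝ) g.integrable.norm) fun ξ ↦ ?_
  refine (norm_integral_le_integral_norm _).trans (le_of_eq ?_)
  simp [convolution_def]

/-- The involution `f ↦ conj (f (-ξ))`, which is complex conjugation in physical space. -/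
noncomputable def refl (f : FreqSpace d) : FreqSpace d :=
  of (fun ξ ↦ (starRingEnd ℂ) (f (-ξ)))
    (Complex.continuous_conj.comp (f.continuous_coe.comp continuous_neg))
    (by
      have h : Tendsto (fun ξ : Space d ↦ -ξ) (cocompact (Space d)) (cocompact (Space d)) :=
        (Homeomorph.neg (Space d)).isClosedEmbedding.tendsto_cocompact
      have h' := (Complex.continuous_conj.tendsto 0).comp (f.tendsto_zero.comp h)
      rw [map_zero] at h'
      exact h')
    (Complex.conjCLE.toContinuousLinearMap.integrable_comp f.integrable.comp_neg)

@[simp]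
theorem refl_apply (f : FreqSpace d) (ξ : Space d) : refl f ξ = (starRingEnd ℂ) (f (-ξ)) := rfl

theorem refl_add (f g : FreqSpace d) : refl (f + g) = refl f + refl g := by ext ξ; simp

@[simp]
theorem l1Norm_refl (f : FreqSpace d) : (refl f).l1Norm = f.l1Norm := by
  simp only [l1Norm_eq, refl_apply, RCLike.norm_conj]
  exact integral_neg_eq_self (fun ξ ↦ ‖f ξ‖) volume

@[simp]
theorem supNorm_refl (f : FreqSpace d) : (refl f).supNorm = f.supNorm := by
  refine le_antisymm (supNorm_le f.supNorm_nonneg fun ξ ↦ by simpa using f.norm_apply_le (-ξ))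
    (supNorm_le (refl f).supNorm_nonneg fun ξ ↦ by simpa using (refl f).norm_apply_le (-ξ))

/-! ### The quintic nonlinearity -/

/-- The quintic form corresponding to `f₁ f̄₂ f₃ f̄₄ f₅` in physical space. -/
noncomputable def quint (f₁ f₂ f₃ f₄ f₅ : FreqSpace d) : FreqSpace d :=
  conv (conv (conv f₁ (refl f₂)) (conv f₃ (refl f₄))) f₅

/-- The nonlinearity `|u|⁴u` on the frequency side. -/
noncomputable def nonlin (f : FreqSpace d) : FreqSpace d := quint f f f f f

theorem l1Norm_quint_le (f₁ f₂ f₃ f₄ f₅ : FreqSpace d) :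
    (quint f₁ f₂ f₃ f₄ f₅).l1Norm ≤
      f₁.l1Norm * f₂.l1Norm * (f₃.l1Norm * f₄.l1Norm) * f₅.l1Norm := by
  have h₁ := l1Norm_conv_le f₁ (refl f₂)
  have h₂ := l1Norm_conv_le f₃ (refl f₄)
  rw [l1Norm_refl] at h₁ h₂
  refine (l1Norm_conv_le _ _).trans (mul_le_mul_of_nonneg_right ?_ f₅.l1Norm_nonneg)
  exact (l1Norm_conv_le _ _).trans (mul_le_mul h₁ h₂ (l1Norm_nonneg _)
    (mul_nonneg f₁.l1Norm_nonneg f₂.l1Norm_nonneg))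

theorem l1Norm_quint_le_of_le {f₁ f₂ f₃ f₄ f₅ : FreqSpace d} {M₁ M₂ M₃ M₄ M₅ : ℝ}
    (h₁ : f₁.l1Norm ≤ M₁) (h₂ : f₂.l1Norm ≤ M₂) (h₃ : f₃.l1Norm ≤ M₃) (h₄ : f₄.l1Norm ≤ M₄)
    (h₅ : f₅.l1Norm ≤ M₅) :
    (quint f₁ f₂ f₃ f₄ f₅).l1Norm ≤ M₁ * M₂ * M₃ * M₄ * M₅ := by
  have p₁ := f₁.l1Norm_nonneg
  have p₂ := f₂.l1Norm_nonneg
  have p₃ := f₃.l1Norm_nonneg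
  have p₄ := f₄.l1Norm_nonneg
  have p₅ := f₅.l1Norm_nonneg
  refine (l1Norm_quint_le f₁ f₂ f₃ f₄ f₅).trans ?_
  rw [← mul_assoc]
  have q₁ := p₁.trans h₁
  have q₂ := p₂.trans h₂
  have q₃ := p₃.trans h₃
  have q₄ := p₄.trans h₄
  gcongr

section SupBounds

variable {f₁ f₂ f₃ f₄ f₅ : FreqSpace d} {M₁ M₂ M₃ M₄ M₅ : ℝ}

theorem supNorm_conv_le_of_le_left (h₁ : f₁.supNorm ≤ M₁) (h₂ : f₂.l1Norm ≤ M₂) :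
    (conv f₁ f₂).supNorm ≤ M₁ * M₂ :=
  (supNorm_conv_le_left _ _).trans
    (mul_le_mul h₁ h₂ (l1Norm_nonneg _) ((supNorm_nonneg _).trans h₁))

theorem supNorm_conv_le_of_le_right (h₁ : f₁.l1Norm ≤ M₁) (h₂ : f₂.supNorm ≤ M₂) :
    (conv f₁ f₂).supNorm ≤ M₁ * M₂ :=
  (supNorm_conv_le_right _ _).trans
    (mul_le_mul h₁ h₂ (supNorm_nonneg _) ((l1Norm_nonneg _).trans h₁))

theorem l1Norm_conv_le_of_le (h₁ : f₁.l1Norm ≤ M₁) (h₂ : f₂.l1Norm ≤ M₂) :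
    (conv f₁ f₂).l1Norm ≤ M₁ * M₂ :=
  (l1Norm_conv_le _ _).trans
    (mul_le_mul h₁ h₂ (l1Norm_nonneg _) ((l1Norm_nonneg _).trans h₁))

/-- A convolution is bounded in the supremum norm by supremum norm times L¹ norm, in either order.
Hence any single one of the five factors may carry the supremum norm, the others being measured in
L¹. -/
theorem supNorm_quint_le_first (h₁ : f₁.supNorm ≤ M₁) (h₂ : f₂.l1Norm ≤ M₂) (h₃ : f₃.l1Norm ≤ M₃)
    (h₄ : f₄.l1Norm ≤ M₄) (h₅ : f₅.l1Norm ≤ M₅) :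
    (quint f₁ f₂ f₃ f₄ f₅).supNorm ≤ M₁ * M₂ * (M₃ * M₄) * M₅ := by
  rw [← l1Norm_refl] at h₂ h₄
  exact supNorm_conv_le_of_le_left (supNorm_conv_le_of_le_left (supNorm_conv_le_of_le_left h₁ h₂)
    (l1Norm_conv_le_of_le h₃ h₄)) h₅

theorem supNorm_quint_le_second (h₁ : f₁.l1Norm ≤ M₁) (h₂ : f₂.supNorm ≤ M₂) (h₃ : f₃.l1Norm ≤ M₃)
    (h₄ : f₄.l1Norm ≤ M₄) (h₅ : f₅.l1Norm ≤ M₅) :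
    (quint f₁ f₂ f₃ f₄ f₅).supNorm ≤ M₁ * M₂ * (M₃ * M₄) * M₅ := by
  rw [← l1Norm_refl] at h₄
  rw [← supNorm_refl] at h₂
  exact supNorm_conv_le_of_le_left (supNorm_conv_le_of_le_left (supNorm_conv_le_of_le_right h₁ h₂)
    (l1Norm_conv_le_of_le h₃ h₄)) h₅

theorem supNorm_quint_le_third (h₁ : f₁.l1Norm ≤ M₁) (h₂ : f₂.l1Norm ≤ M₂) (h₃ : f₃.supNorm ≤ M₃)
    (h₄ : f₄.l1Norm ≤ M₄) (h₅ : f₅.l1Norm ≤ M₅) :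
    (quint f₁ f₂ f₃ f₄ f₅).supNorm ≤ M₁ * M₂ * (M₃ * M₄) * M₅ := by
  rw [← l1Norm_refl] at h₂ h₄
  exact supNorm_conv_le_of_le_left (supNorm_conv_le_of_le_right (l1Norm_conv_le_of_le h₁ h₂)
    (supNorm_conv_le_of_le_left h₃ h₄)) h₅

theorem supNorm_quint_le_fourth (h₁ : f₁.l1Norm ≤ M₁) (h₂ : f₂.l1Norm ≤ M₂) (h₃ : f₃.l1Norm ≤ M₃)
    (h₄ : f₄.supNorm ≤ M₄) (h₅ : f₅.l1Norm ≤ M₅) :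
    (quint f₁ f₂ f₃ f₄ f₅).supNorm ≤ M₁ * M₂ * (M₃ * M₄) * M₅ := by
  rw [← l1Norm_refl] at h₂
  rw [← supNorm_refl] at h₄
  exact supNorm_conv_le_of_le_left (supNorm_conv_le_of_le_right (l1Norm_conv_le_of_le h₁ h₂)
    (supNorm_conv_le_of_le_right h₃ h₄)) h₅

theorem supNorm_quint_le_fifth (h₁ : f₁.l1Norm ≤ M₁) (h₂ : f₂.l1Norm ≤ M₂) (h₃ : f₃.l1Norm ≤ M₃)
    (h₄ : f₄.l1Norm ≤ M₄) (h₅ : f₅.supNorm ≤ M₅) :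
    (quint f₁ f₂ f₃ f₄ f₅).supNorm ≤ M₁ * M₂ * (M₃ * M₄) * M₅ := by
  rw [← l1Norm_refl] at h₂ h₄
  exact supNorm_conv_le_of_le_right (l1Norm_conv_le_of_le (l1Norm_conv_le_of_le h₁ h₂)
    (l1Norm_conv_le_of_le h₃ h₄)) h₅

end SupBounds

/-- Telescoping: a term of the expansion containing h is sorted by the first slot in which h occurs.
-/
theorem nonlin_add (f h : FreqSpace d) :
    nonlin (f + h) = nonlin f + (quint h (f + h) (f + h) (f + h) (f + h) +
      quint f h (f + h) (f + h) (f + h) + quint f f h (f + h) (f + h) + quint f f f h (f + h) +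
      quint f f f f h) := by
  simp only [nonlin, quint, conv_add_left, conv_add_right, refl_add]
  abel

/-- The terms that are neither all a nor all b are sorted by their first letter and by the first
slot where the other letter appears. Thus each of the eight groups displays an a and a b. -/
theorem nonlin_add_sub_sub (a b : FreqSpace d) :
    nonlin (a + b) - nonlin b - nonlin a =
      (quint b a (a + b) (a + b) (a + b) + quint b b a (a + b) (a + b) +
        quint b b b a (a + b) + quint b b b b a) +
      (quint a b (a + b) (a + b) (a + b) + quint a a b (a + b) (a + b) +
        quint a a a b (a + b) + quint a a a a b) := by
  simp only [nonlin, quint, conv_add_left, conv_add_right, refl_add]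
  abel

theorem supNorm_sum_five_le {f₁ f₂ f₃ f₄ f₅ : FreqSpace d} {C : ℝ} (h₁ : f₁.supNorm ≤ C)
    (h₂ : f₂.supNorm ≤ C) (h₃ : f₃.supNorm ≤ C) (h₄ : f₄.supNorm ≤ C) (h₅ : f₅.supNorm ≤ C) :
    (f₁ + f₂ + f₃ + f₄ + f₅).supNorm ≤ 5 * C := by
  linarith [supNorm_add_le (f₁ + f₂ + f₃ + f₄) f₅, supNorm_add_le (f₁ + f₂ + f₃) f₄,
    supNorm_add_le (f₁ + f₂) f₃, supNorm_add_le f₁ f₂]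

theorem l1Norm_nonlin_sub_le {f g : FreqSpace d} {M : ℝ} (hf : f.l1Norm ≤ M) (hg : g.l1Norm ≤ M) :
    (nonlin g - nonlin f).l1Norm ≤ 5 * M ^ 4 * (g - f).l1Norm := by
  obtain ⟨h, rfl⟩ : ∃ h, g = f + h := ⟨g - f, by abel⟩
  rw [nonlin_add, add_sub_cancel_left, add_sub_cancel_left]
  have a₁ := l1Norm_quint_le_of_le le_rfl hg hg hg hg (f₁ := h)
  have a₂ := l1Norm_quint_le_of_le hf le_rfl hg hg hg (f₂ := h)
  have a₃ := l1Norm_quint_le_of_le hf hf le_rfl hg hg (f₃ := h)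
  have a₄ := l1Norm_quint_le_of_le hf hf hf le_rfl hg (f₄ := h)
  have a₅ := l1Norm_quint_le_of_le hf hf hf hf le_rfl (f₅ := h)
  refine (l1Norm_add_le _ _).trans ((add_le_add ((l1Norm_add_le _ _).trans (add_le_add
    ((l1Norm_add_le _ _).trans (add_le_add ((l1Norm_add_le _ _).trans (add_le_add a₁ a₂)) a₃))
    a₄)) a₅).trans (le_of_eq (by ring)))

theorem supNorm_nonlin_sub_le {f g : FreqSpace d} {M : ℝ} (hf : f.l1Norm ≤ M) (hg : g.l1Norm ≤ M) :
    (nonlin g - nonlin f).supNorm ≤ 5 * M ^ 4 * (g - f).supNorm := by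
  obtain ⟨h, rfl⟩ : ∃ h, g = f + h := ⟨g - f, by abel⟩
  rw [nonlin_add, add_sub_cancel_left, add_sub_cancel_left, mul_assoc]
  have a₁ := supNorm_quint_le_first le_rfl hg hg hg hg (f₁ := h)
  have a₂ := supNorm_quint_le_second hf le_rfl hg hg hg (f₂ := h)
  have a₃ := supNorm_quint_le_third hf hf le_rfl hg hg (f₃ := h)
  have a₄ := supNorm_quint_le_fourth hf hf hf le_rfl hg (f₄ := h)
  have a₅ := supNorm_quint_le_fifth hf hf hf hf le_rfl (f₅ := h)
  ring_nf at a₁ a₂ a₃ a₄ a₅ ⊢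
  rw [mul_comm _ (5 : ℝ)]
  exact supNorm_sum_five_le a₁ a₂ a₃ a₄ a₅

/-- The difference of the nonlinearities in the supremum norm, with the difference of the arguments
measured in `L¹`. -/
theorem supNorm_nonlin_sub_le_l1Norm {f g : FreqSpace d} {M K : ℝ} (hf : f.l1Norm ≤ M)
    (hg : g.l1Norm ≤ M) (hf' : f.supNorm ≤ K) (hg' : g.supNorm ≤ K) :
    (nonlin g - nonlin f).supNorm ≤ 5 * (K * M ^ 3 * (g - f).l1Norm) := by
  obtain ⟨h, rfl⟩ : ∃ h, g = f + h := ⟨g - f, by abel⟩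
  rw [nonlin_add, add_sub_cancel_left, add_sub_cancel_left]
  have a₁ := supNorm_quint_le_fifth le_rfl hg hg hg hg' (f₁ := h)
  have a₂ := supNorm_quint_le_first hf' le_rfl hg hg hg (f₂ := h)
  have a₃ := supNorm_quint_le_first hf' hf le_rfl hg hg (f₃ := h)
  have a₄ := supNorm_quint_le_first hf' hf hf le_rfl hg (f₄ := h)
  have a₅ := supNorm_quint_le_first hf' hf hf hf le_rfl (f₅ := h)
  ring_nf at a₁ a₂ a₃ a₄ a₅ ⊢
  rw [mul_comm _ (5 : ℝ)]
  exact supNorm_sum_five_le (a₁.trans_eq (by ring)) a₂ a₃ a₄ a₅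

/-- The interaction of two functions through the nonlinearity, with one of them measured in `L¹` and
the other one in the supremum norm. -/
theorem supNorm_nonlin_add_sub_sub_le {a b : FreqSpace d} {M P K : ℝ} (ha : a.l1Norm ≤ M)
    (hab : (a + b).l1Norm ≤ M) (hb : b.l1Norm ≤ P) (hPM : P ≤ M) (ha' : a.supNorm ≤ K) :
    (nonlin (a + b) - nonlin b - nonlin a).supNorm ≤ 8 * (P * K * M ^ 3) := by
  have hbM := hb.trans hPM
  rw [nonlin_add_sub_sub]
  have a₁ := supNorm_quint_le_second hb ha' hab hab hab
  have a₂ := supNorm_quint_le_third hb hbM ha' hab hab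
  have a₃ := supNorm_quint_le_fourth hb hbM hbM ha' hab
  have a₄ := supNorm_quint_le_fifth hb hbM hbM hbM ha'
  have b₁ := supNorm_quint_le_first ha' hb hab hab hab
  have b₂ := supNorm_quint_le_first ha' ha hb hab hab
  have b₃ := supNorm_quint_le_first ha' ha ha hb hab
  have b₄ := supNorm_quint_le_first ha' ha ha ha hb
  refine (supNorm_add_le _ _).trans ((add_le_add
    ((supNorm_add_le _ _).trans (add_le_add ((supNorm_add_le _ _).trans (add_le_add
      ((supNorm_add_le _ _).trans (add_le_add a₁ a₂)) a₃)) a₄))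
    ((supNorm_add_le _ _).trans (add_le_add ((supNorm_add_le _ _).trans (add_le_add
      ((supNorm_add_le _ _).trans (add_le_add b₁ b₂)) b₃)) b₄))).trans (le_of_eq (by ring)))

theorem norm_nonlin_sub_le {f g : FreqSpace d} {M : ℝ} (hf : ‖f‖ ≤ M) (hg : ‖g‖ ≤ M) :
    ‖nonlin g - nonlin f‖ ≤ 5 * M ^ 4 * ‖g - f‖ := by
  have hM : 0 ≤ M := (norm_nonneg f).trans hf
  have h₁ := f.l1Norm_le_norm.trans hf
  have h₂ := g.l1Norm_le_norm.trans hg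
  rw [norm_eq, norm_eq (g - f)]
  refine max_le ((supNorm_nonlin_sub_le h₁ h₂).trans ?_) ((l1Norm_nonlin_sub_le h₁ h₂).trans ?_)
  · gcongr; exact le_max_left _ _
  · gcongr; exact le_max_right _ _

theorem norm_nonlin_le (f : FreqSpace d) : ‖nonlin f‖ ≤ ‖f‖ ^ 5 := by
  have h := f.l1Norm_le_norm
  rw [norm_eq]
  refine max_le ((supNorm_quint_le_first f.supNorm_le_norm h h h h).trans_eq (by ring))
    ((l1Norm_quint_le_of_le h h h h h).trans_eq (by ring))

end FreqSpace
-- Local existence in the interaction picture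
/-- A Picard-Lindelöf solution that is known to stay in the closed ball. -/
theorem _root_.IsPicardLindelof.exists_hasDerivWithinAt_mem_closedBall {E : Type*}
    [NormedAddCommGroup E] [NormedSpace ℝ E] [CompleteSpace E] {f : ℝ → E → E} {tmin tmax : ℝ}
    {t₀ : Icc tmin tmax} {x₀ : E} {a L K : NNReal} (hf : IsPicardLindelof f t₀ x₀ a 0 L K) :
    ∃ α : ℝ → E, α t₀ = x₀ ∧ (∀ t ∈ Icc tmin tmax, α t ∈ Metric.closedBall x₀ a) ∧
      ∀ t ∈ Icc tmin tmax, HasDerivWithinAt α (f t (α t)) (Icc tmin tmax) t := by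
  have hx : x₀ ∈ Metric.closedBall x₀ ((0 : NNReal) : ℝ) := Metric.mem_closedBall_self le_rfl
  obtain ⟨α, hα⟩ := ODE.FunSpace.exists_isFixedPt_next hf hx
  refine ⟨α.compProj, by rw [ODE.FunSpace.compProj_val, ← hα, ODE.FunSpace.next_apply₀],
    fun t _ ↦ α.compProj_mem_closedBall hf.mul_max_le, fun t ht ↦ ?_⟩
  apply ODE.hasDerivWithinAt_picard_Icc t₀.2 hf.continuousOn_uncurry
    α.continuous_compProj.continuousOn (fun _ _ ↦ α.compProj_mem_closedBall hf.mul_max_le)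
    x₀ ht |>.congr_of_mem _ ht
  intro t' ht'
  nth_rw 1 [← hα]
  rw [ODE.FunSpace.compProj_of_mem ht', ODE.FunSpace.next_apply]

namespace FreqSpace

variable {d : ℕ}

/-- The vector field of the equation in the interaction picture, on the frequency side. -/
noncomputable def field (μ t : ℝ) (z : FreqSpace d) : FreqSpace d :=
  ((μ : ℂ) * Complex.I) • evol (-t) (nonlin (evol t z))

/-- `z` is a solution on `[0,T]` in the interaction picture, on the frequency side. -/
def IsProfile (μ T : ℝ) (z : ℝ → FreqSpace d) : Prop :=
  ∀ t ∈ Icc 0 T, HasDerivWithinAt z (field μ t (z t)) (Icc 0 T) t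

theorem IsProfile.continuousOn {μ T : ℝ} {z : ℝ → FreqSpace d} (hz : IsProfile μ T z) :
    ContinuousOn z (Icc 0 T) := fun t ht ↦ (hz t ht).continuousWithinAt

theorem norm_coeff {μ : ℝ} (hμ : |μ| = 1) : ‖(μ : ℂ) * Complex.I‖ = 1 := by simp [hμ]

theorem norm_field_sub_le {μ : ℝ} (hμ : |μ| = 1) {t M : ℝ} {z w : FreqSpace d} (hz : ‖z‖ ≤ M)
    (hw : ‖w‖ ≤ M) : ‖field μ t w - field μ t z‖ ≤ 5 * M ^ 4 * ‖w - z‖ := by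
  rw [field, field, ← smul_sub, norm_smul, norm_coeff hμ, one_mul, ← evol_sub, norm_evol]
  refine (norm_nonlin_sub_le (M := M) (by simpa) (by simpa)).trans_eq ?_
  rw [← evol_sub, norm_evol]

theorem norm_field_le {μ : ℝ} (hμ : |μ| = 1) (t : ℝ) (z : FreqSpace d) :
    ‖field μ t z‖ ≤ ‖z‖ ^ 5 := by
  rw [field, norm_smul, norm_coeff hμ, one_mul, norm_evol]
  simpa using norm_nonlin_le (evol t z)

theorem continuous_nonlin : Continuous (nonlin (d := d)) := by
  rw [continuous_iff_continuousAt]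
  intro f
  rw [ContinuousAt, tendsto_iff_norm_sub_tendsto_zero]
  have h : Tendsto (fun g : FreqSpace d ↦ 5 * (‖f‖ + 1) ^ 4 * ‖g - f‖) (𝓝 f) (𝓝 0) := by
    have : Continuous fun g : FreqSpace d ↦ 5 * (‖f‖ + 1) ^ 4 * ‖g - f‖ := by fun_prop
    simpa using this.tendsto f
  refine squeeze_zero' (Eventually.of_forall fun _ ↦ norm_nonneg _) ?_ h
  filter_upwards [Metric.ball_mem_nhds f one_pos] with g hg
  rw [Metric.mem_ball, dist_eq_norm] at hg
  refine norm_nonlin_sub_le (by linarith) ?_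
  have := norm_add_le (g - f) f
  rw [sub_add_cancel] at this
  linarith

theorem continuous_field (μ : ℝ) (z : FreqSpace d) : Continuous fun t ↦ field μ t z := by
  rw [← continuousOn_univ]
  have h : ContinuousOn (fun t ↦ evol (-t) (nonlin (evol t z))) univ :=
    continuous_neg.continuousOn.evol (continuous_nonlin.comp (continuous_evol z)).continuousOn
  exact h.const_smul ((μ : ℂ) * Complex.I)

/-- Local existence on a time interval determined by the size of the data. -/
theorem exists_isProfile {μ : ℝ} (hμ : |μ| = 1) {f : FreqSpace d} {M T : ℝ} (hM : 0 ≤ M)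
    (hT : 0 ≤ T) (hf : ‖f‖ ≤ M) (hTM : 32 * (T * M ^ 4) ≤ 1) :
    ∃ z : ℝ → FreqSpace d, z 0 = f ∧ IsProfile μ T z ∧ ∀ t ∈ Icc 0 T, ‖z t‖ ≤ 2 * M := by
  have hball : ∀ z ∈ Metric.closedBall f M, ‖z‖ ≤ 2 * M := by
    intro z hz
    rw [Metric.mem_closedBall, dist_eq_norm] at hz
    have := norm_add_le (z - f) f
    rw [sub_add_cancel] at this
    linarith
  have hPL : IsPicardLindelof (field μ) (⟨0, left_mem_Icc.2 hT⟩ : Icc 0 T) f ⟨M, hM⟩ 0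
      ⟨(2 * M) ^ 5, by positivity⟩ ⟨5 * (2 * M) ^ 4, by positivity⟩ := by
    refine ⟨fun t _ ↦ LipschitzOnWith.of_dist_le_mul fun z hz w hw ↦ ?_,
      fun z _ ↦ (continuous_field μ z).continuousOn, fun t _ z hz ↦ ?_, ?_⟩
    · rw [dist_eq_norm, dist_eq_norm]
      exact norm_field_sub_le hμ (hball w hw) (hball z hz)
    · refine (norm_field_le hμ t z).trans ?_
      have := hball z hz
      change _ ≤ (2 * M) ^ 5
      gcongr
    -- On the ball of radius M around f the field is at most (2M)⁵ = 32 M⁵, so `hTM` keeps the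
    -- solution in that ball.
    · change (2 * M) ^ 5 * max (T - 0) (0 - 0) ≤ M - 0
      rw [sub_zero, sub_zero, sub_zero, max_eq_left hT]
      nlinarith
  obtain ⟨z, h₀, hb, hd⟩ := hPL.exists_hasDerivWithinAt_mem_closedBall
  exact ⟨z, h₀, hd, fun t ht ↦ hball _ (hb t ht)⟩


/-! ### Comparison of two solutions at short times -/

variable {μ T M P K Λ : ℝ} {w b : ℝ → FreqSpace d}

theorem _root_.ContinuousLinearMap.hasDerivWithinAt_comp {E F : Type*} [NormedAddCommGroup E]
    [NormedSpace ℂ E] [NormedAddCommGroup F] [NormedSpace ℂ F] (L : E →L[ℂ] F) {f : ℝ → E} {f' : E}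
    {s : Set ℝ} {t : ℝ} (hf : HasDerivWithinAt f f' s t) :
    HasDerivWithinAt (fun r ↦ L (f r)) (L f') s t :=
  (L.restrictScalars ℝ).hasFDerivAt.comp_hasDerivWithinAt t hf

theorem field_sub (μ t : ℝ) (z y : FreqSpace d) :
    field μ t z - field μ t y =
      ((μ : ℂ) * Complex.I) • evol (-t) (nonlin (evol t z) - nonlin (evol t y)) := by
  rw [field, field, ← smul_sub, evol_sub]

theorem supNorm_field_sub_le (hμ : |μ| = 1) {t : ℝ} {z y : FreqSpace d} (hz : z.l1Norm ≤ M)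
    (hy : y.l1Norm ≤ M) : (field μ t z - field μ t y).supNorm ≤ 5 * M ^ 4 * (z - y).supNorm := by
  rw [field_sub, supNorm_smul, norm_coeff hμ, one_mul, supNorm_evol]
  refine (supNorm_nonlin_sub_le (M := M) (by simpa) (by simpa)).trans_eq ?_
  rw [← evol_sub, supNorm_evol]

theorem l1Norm_field_sub_le (hμ : |μ| = 1) {t : ℝ} {z y : FreqSpace d} (hz : z.l1Norm ≤ M)
    (hy : y.l1Norm ≤ M) : (field μ t z - field μ t y).l1Norm ≤ 5 * M ^ 4 * (z - y).l1Norm := by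
  rw [field_sub, l1Norm_smul, norm_coeff hμ, one_mul, l1Norm_evol]
  refine (l1Norm_nonlin_sub_le (M := M) (by simpa) (by simpa)).trans_eq ?_
  rw [← evol_sub, l1Norm_evol]

/-- The difference of two solutions at most doubles in the supremum norm on a short time
interval. -/
theorem supNorm_sub_le_of_isProfile (hμ : |μ| = 1) (hT : 0 ≤ T) (hw : IsProfile μ T w)
    (hb : IsProfile μ T b) (hwM : ∀ t ∈ Icc 0 T, (w t).l1Norm ≤ M)
    (hbM : ∀ t ∈ Icc 0 T, (b t).l1Norm ≤ M) (hTM : 10 * (T * M ^ 4) ≤ 1) {t : ℝ}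
    (ht : t ∈ Icc 0 T) : (w t - b t).supNorm ≤ 2 * (w 0 - b 0).supNorm := by
  have hcont : ContinuousOn (fun t ↦ (w t - b t).supNorm) (Icc 0 T) :=
    (toC0.continuous.comp_continuousOn (hw.continuousOn.sub hb.continuousOn)).norm
  -- Instead of Grönwall: at a time r of maximal difference, the mean value inequality bounds the
  -- maximum by its initial value plus 5M⁴T times itself, and `hTM` makes that factor at most 1/2.
  obtain ⟨r, hr, hmax⟩ := isCompact_Icc.exists_isMaxOn ⟨0, left_mem_Icc.2 hT⟩ hcont
  have hmax' : ∀ t ∈ Icc 0 T, (w t - b t).supNorm ≤ (w r - b r).supNorm := hmax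
  have h := Convex.norm_image_sub_le_of_norm_hasDerivWithin_le
    (f := fun t ↦ toC0 (w t - b t)) (C := 5 * M ^ 4 * (w r - b r).supNorm)
    (fun t ht ↦ toC0.hasDerivWithinAt_comp ((hw t ht).sub (hb t ht)))
    (fun t ht ↦ (supNorm_field_sub_le hμ (hwM t ht) (hbM t ht)).trans
      (mul_le_mul_of_nonneg_left (hmax' t ht) (by positivity)))
    (convex_Icc 0 T) (left_mem_Icc.2 hT) hr
  have h₁ : (w r - b r).supNorm ≤ (w 0 - b 0).supNorm + 5 * M ^ 4 * (w r - b r).supNorm * T := by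
    have h₂ := norm_add_le (toC0 (w r - b r) - toC0 (w 0 - b 0)) (toC0 (w 0 - b 0))
    rw [sub_add_cancel] at h₂
    have h₃ : 5 * M ^ 4 * (w r - b r).supNorm * ‖r - 0‖ ≤ 5 * M ^ 4 * (w r - b r).supNorm * T := by
      rw [sub_zero, Real.norm_of_nonneg hr.1]
      exact mul_le_mul_of_nonneg_left hr.2
        (mul_nonneg (by positivity) (supNorm_nonneg _))
    simp only [supNorm] at h h₃ ⊢
    linarith
  have h₄ := mul_le_mul_of_nonneg_right hTM (supNorm_nonneg (w r - b r))
  linarith [hmax' t ht]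

/-- The mean value inequality in L¹, with the crude bound M for the difference. It only has to show
that the difference hardly moves away from its initial value. -/
theorem l1Norm_sub_sub_le_of_isProfile (hμ : |μ| = 1) (hT : 0 ≤ T) (hw : IsProfile μ T w)
    (hb : IsProfile μ T b) (hwM : ∀ t ∈ Icc 0 T, (w t).l1Norm ≤ M)
    (hbM : ∀ t ∈ Icc 0 T, (b t).l1Norm ≤ M) (hwbM : ∀ t ∈ Icc 0 T, (w t - b t).l1Norm ≤ M) {t : ℝ}
    (ht : t ∈ Icc 0 T) : (w t - b t - (w 0 - b 0)).l1Norm ≤ 5 * M ^ 5 * T := by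
  have hM : 0 ≤ M := (l1Norm_nonneg _).trans (hwM t ht)
  have h := Convex.norm_image_sub_le_of_norm_hasDerivWithin_le
    (f := fun t ↦ toL1 (w t - b t)) (C := 5 * M ^ 4 * M)
    (fun t ht ↦ toL1.hasDerivWithinAt_comp ((hw t ht).sub (hb t ht)))
    (fun t ht ↦ (l1Norm_field_sub_le hμ (hwM t ht) (hbM t ht)).trans
      (mul_le_mul_of_nonneg_left (hwbM t ht) (by positivity)))
    (convex_Icc 0 T) (left_mem_Icc.2 hT) ht
  rw [← map_sub, sub_zero, Real.norm_of_nonneg ht.1] at h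
  refine h.trans ?_
  calc 5 * M ^ 4 * M * t = 5 * M ^ 5 * t := by ring
    _ ≤ _ := mul_le_mul_of_nonneg_left ht.2 (by positivity)

/-- On the support of f the phase differs from 1 by at most tΛ. -/
theorem l1Norm_evol_sub_le {f : FreqSpace d} (hf : ∀ ξ, f ξ ≠ 0 → symbol ξ ≤ Λ) {t : ℝ}
    (ht : 0 ≤ t) : (evol t f - f).l1Norm ≤ t * Λ * f.l1Norm := by
  refine l1Norm_le_of_norm_le fun ξ ↦ ?_
  by_cases h : f ξ = 0
  · simp [h]
  · rw [sub_apply, evol_apply, ← sub_one_mul, norm_mul]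
    refine mul_le_mul_of_nonneg_right ((norm_phase_sub_one_le t ξ).trans ?_) (norm_nonneg _)
    rw [abs_of_nonneg ht]
    exact mul_le_mul_of_nonneg_left (hf ξ h) ht

/-- At short times the difference of two solutions is given by the nonlinearity applied to the
difference of the data, up to an error that is small in the supremum norm. -/
theorem norm_sub_sub_nonlin_le (hμ : |μ| = 1) (hT : 0 ≤ T) (hw : IsProfile μ T w)
    (hb : IsProfile μ T b) (hwM : ∀ t ∈ Icc 0 T, (w t).l1Norm ≤ M)
    (hbP : ∀ t ∈ Icc 0 T, (b t).l1Norm ≤ P) (hPM : P ≤ M)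
    (hwbM : ∀ t ∈ Icc 0 T, (w t - b t).l1Norm ≤ M) (hTM : 10 * (T * M ^ 4) ≤ 1)
    (hK : (w 0 - b 0).supNorm ≤ K) (hΛ : ∀ ξ, (w 0 - b 0) ξ ≠ 0 → symbol ξ ≤ Λ)
    {ξ : Space d} (hξ : symbol ξ ≤ Λ) :
    ‖(w T - b T) ξ - (w 0 - b 0) ξ - T * ((μ : ℂ) * Complex.I * nonlin (w 0 - b 0) ξ)‖ ≤
      K * M ^ 3 * (16 * P + 50 * (T * M ^ 5) + 11 * (T * Λ * M)) * T := by
  set φ := w 0 - b 0 with hφ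
  have h0 : (0 : ℝ) ∈ Icc 0 T := left_mem_Icc.2 hT
  have hbM : ∀ t ∈ Icc 0 T, (b t).l1Norm ≤ M := fun t ht ↦ (hbP t ht).trans hPM
  have hM : 0 ≤ M := (l1Norm_nonneg _).trans (hwM 0 h0)
  have hK₀ : 0 ≤ K := (supNorm_nonneg _).trans hK
  have hΛ₀ : 0 ≤ Λ := (symbol_nonneg ξ).trans hξ
  have hbound : ∀ t ∈ Icc 0 T, ‖evalCLM ξ (field μ t (w t) - field μ t (b t)) -
      (μ : ℂ) * Complex.I * nonlin φ ξ‖ ≤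
        K * M ^ 3 * (16 * P + 50 * (T * M ^ 5) + 11 * (T * Λ * M)) := by
    intro t ht
    set a := evol t (w t - b t) with ha
    set c := evol t (b t) with hc
    have hac : evol t (w t) = a + c := by rw [ha, hc, evol_sub]; abel
    have hsup : (w t - b t).supNorm ≤ 2 * K :=
      (supNorm_sub_le_of_isProfile hμ hT hw hb hwM hbM hTM ht).trans (by linarith)
    have haM : a.l1Norm ≤ M := by rw [ha, l1Norm_evol]; exact hwbM t ht
    have hφM : φ.l1Norm ≤ M := hwbM 0 h0
    have haK : a.supNorm ≤ 2 * K := by rwa [ha, supNorm_evol]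
    have hinter : (nonlin (a + c) - nonlin c - nonlin a).supNorm ≤ 8 * (P * (2 * K) * M ^ 3) := by
      refine supNorm_nonlin_add_sub_sub_le haM ?_ ?_ hPM haK
      · rw [← hac, l1Norm_evol]; exact hwM t ht
      · rw [hc, l1Norm_evol]; exact hbP t ht
    have hdist : (a - φ).l1Norm ≤ 5 * M ^ 5 * T + T * Λ * M := by
      have e : a - φ = evol t (w t - b t - φ) + (evol t φ - φ) := by
        rw [ha, evol_sub t (w t - b t) φ]; abel
      rw [e]
      refine (l1Norm_add_le _ _).trans (add_le_add ?_ ?_)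
      · rw [l1Norm_evol]
        exact l1Norm_sub_sub_le_of_isProfile hμ hT hw hb hwM hbM hwbM ht
      · refine (l1Norm_evol_sub_le hΛ ht.1).trans ?_
        have := ht.2
        gcongr
        exact φ.l1Norm_nonneg
    have hcub : (nonlin a - nonlin φ).supNorm ≤
        5 * ((2 * K) * M ^ 3 * (5 * M ^ 5 * T + T * Λ * M)) := by
      refine (supNorm_nonlin_sub_le_l1Norm hφM haM (hK.trans (by linarith)) haK).trans ?_
      gcongr
    have hosc : ‖(phase (-t) ξ - 1) * nonlin φ ξ‖ ≤ T * Λ * (K * M ^ 4) := by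
      rw [norm_mul]
      refine mul_le_mul ?_ ?_ (norm_nonneg _) (by positivity)
      · refine (norm_phase_sub_one_le (-t) ξ).trans ?_
        rw [abs_neg, abs_of_nonneg ht.1]
        exact mul_le_mul ht.2 hξ (symbol_nonneg ξ) hT
      · refine (norm_apply_le _ ξ).trans
          ((supNorm_quint_le_first hK hφM hφM hφM hφM).trans_eq (by ring))
    -- Three errors: the interaction of a with the background c, the replacement of a by its initial
    -- value φ, and the outer phase.
    have hsplit : evalCLM ξ (field μ t (w t) - field μ t (b t)) -
        (μ : ℂ) * Complex.I * nonlin φ ξ = (μ : ℂ) * Complex.I *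
          (phase (-t) ξ * (nonlin (a + c) - nonlin c - nonlin a) ξ +
            phase (-t) ξ * (nonlin a - nonlin φ) ξ + (phase (-t) ξ - 1) * nonlin φ ξ) := by
      rw [field_sub, hac, evalCLM_apply, smul_apply, evol_apply]
      simp only [sub_apply]
      ring
    rw [hsplit, norm_mul, norm_coeff hμ, one_mul]
    refine (norm_add₃_le).trans ?_
    rw [norm_mul, norm_phase, one_mul, norm_mul, norm_phase, one_mul]
    have h₁ := (norm_apply_le _ ξ).trans hinter
    have h₂ := (norm_apply_le _ ξ).trans hcub
    linarith
  have hlin : ∀ t, HasDerivWithinAt (fun t : ℝ ↦ (t : ℂ) * ((μ : ℂ) * Complex.I * nonlin φ ξ))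
      ((μ : ℂ) * Complex.I * nonlin φ ξ) (Icc 0 T) t := fun t ↦ by
    simpa using! (Complex.ofRealCLM.hasDerivWithinAt (x := t) (s := Icc 0 T)).mul_const
      ((μ : ℂ) * Complex.I * nonlin φ ξ)
  -- The expected linear growth is subtracted first, so that the derivative consists of the error
  -- alone.
  have h := Convex.norm_image_sub_le_of_norm_hasDerivWithin_le
    (f := fun t : ℝ ↦ evalCLM ξ (w t - b t) - (t : ℂ) * ((μ : ℂ) * Complex.I * nonlin φ ξ))
    (f' := fun t ↦ evalCLM ξ (field μ t (w t) - field μ t (b t)) -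
      (μ : ℂ) * Complex.I * nonlin φ ξ)
    (fun t ht ↦ ((evalCLM ξ).hasDerivWithinAt_comp ((hw t ht).sub (hb t ht))).sub
      (hlin t))
    hbound (convex_Icc 0 T) h0 (right_mem_Icc.2 hT)
  rw [sub_zero, Real.norm_of_nonneg hT] at h
  refine le_of_eq_of_le (congrArg norm ?_) h
  rw [evalCLM_apply, evalCLM_apply, ← hφ, Complex.ofReal_zero]
  ring



/-- A continuous function with compact support as an element of `C₀ ∩ L¹`. -/
noncomputable def ofCompactSupport (f : Space d → ℂ) (hc : Continuous f) (hs : HasCompactSupport f) :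
    FreqSpace d :=
  of f hc hs.is_zero_at_infty (hc.integrable_of_hasCompactSupport hs)

@[simp]
theorem ofCompactSupport_apply {f : Space d → ℂ} (hc : Continuous f) (hs : HasCompactSupport f)
    (ξ : Space d) : ofCompactSupport f hc hs ξ = f ξ := rfl

/-! ### Lower bounds for convolutions -/

/-- The volume of the unit ball. -/
noncomputable def ballVol (d : ℕ) : ℝ := volume.real (Metric.ball (0 : Space d) 1)

theorem ballVol_pos : 0 < ballVol d :=
  ENNReal.toReal_pos (Metric.measure_ball_pos _ _ one_pos).ne' measure_ball_lt_top.ne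

theorem volume_real_ball (x : Space d) {r : ℝ} (hr : 0 < r) :
    volume.real (Metric.ball x r) = r ^ d * ballVol d := by
  rw [measureReal_def, Measure.addHaar_ball_of_pos _ _ hr, ENNReal.toReal_mul, ballVol,
    measureReal_def, ENNReal.toReal_ofReal (by positivity), finrank_euclideanSpace_fin]

/-- `f` is nonnegative, and at least `α` on the ball of radius `r` around `η`. -/
def MinorizedOn (f : FreqSpace d) (η : Space d) (r α : ℝ) : Prop :=
  ∃ g : Space d → ℝ, (∀ ξ, f ξ = g ξ) ∧ (∀ ξ, 0 ≤ g ξ) ∧ ∀ ξ ∈ Metric.ball η r, α ≤ g ξ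

theorem MinorizedOn.le_norm {f : FreqSpace d} {η ξ : Space d} {r α : ℝ} (h : MinorizedOn f η r α)
    (hξ : ξ ∈ Metric.ball η r) : α ≤ ‖f ξ‖ := by
  obtain ⟨g, hg, hg₀, hgα⟩ := h
  rw [hg, Complex.norm_real, Real.norm_of_nonneg (hg₀ ξ)]
  exact hgα ξ hξ

theorem MinorizedOn.refl {f : FreqSpace d} {η : Space d} {r α : ℝ} (h : MinorizedOn f η r α) :
    MinorizedOn (refl f) (-η) r α := by
  obtain ⟨g, hg, hg₀, hgα⟩ := h
  refine ⟨fun ξ ↦ g (-ξ), fun ξ ↦ by simp [hg], fun ξ ↦ hg₀ _, fun ξ hξ ↦ hgα _ ?_⟩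
  rw [Metric.mem_ball, dist_eq_norm] at hξ ⊢
  rwa [← norm_neg, neg_sub, sub_neg_eq_add, add_comm, ← sub_neg_eq_add]

/-- Write ξ = η₁ + η₂ + 2v with |v| < r/2. For η in the ball of radius r/2 around η₁ + v, the point
ξ − η lies in the ball of the same radius around η₂ + v. Both balls are inside the original ones,
and nonnegativity discards the other η. Splitting the shift evenly preserves the radius r under
iteration. -/
theorem MinorizedOn.conv {f₁ f₂ : FreqSpace d} {η₁ η₂ : Space d} {r α₁ α₂ : ℝ} (hr : 0 < r)
    (hα₂ : 0 ≤ α₂) (h₁ : MinorizedOn f₁ η₁ r α₁) (h₂ : MinorizedOn f₂ η₂ r α₂) :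
    MinorizedOn (conv f₁ f₂) (η₁ + η₂) r (α₁ * α₂ * ((r / 2) ^ d * ballVol d)) := by
  obtain ⟨g₁, hg₁, hp₁, hl₁⟩ := h₁
  obtain ⟨g₂, hg₂, hp₂, hl₂⟩ := h₂
  have hint : ∀ ξ, Integrable fun η ↦ g₁ η * g₂ (ξ - η) := fun ξ ↦ by
    have := (f₁.integrable_conv_integrand f₂ ξ).re
    simpa [hg₁, hg₂] using this
  refine ⟨fun ξ ↦ ∫ η, g₁ η * g₂ (ξ - η), fun ξ ↦ ?_,
    fun ξ ↦ integral_nonneg fun η ↦ mul_nonneg (hp₁ _) (hp₂ _), fun ξ hξ ↦ ?_⟩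
  · rw [conv_apply, ← integral_complex_ofReal]
    simp [hg₁, hg₂]
  · rw [Metric.mem_ball, dist_eq_norm] at hξ
    set v := (1 / 2 : ℝ) • (ξ - (η₁ + η₂)) with hv
    have hvn : ‖v‖ < r / 2 := by
      rw [hv, norm_smul, Real.norm_of_nonneg (by norm_num)]; linarith
    have hξv : ξ = η₁ + η₂ + v + v := by
      rw [hv, add_assoc, ← add_smul]; norm_num
    calc α₁ * α₂ * ((r / 2) ^ d * ballVol d)
        = ∫ _ in Metric.ball (η₁ + v) (r / 2), α₁ * α₂ := by
          rw [setIntegral_const, volume_real_ball _ (by positivity), smul_eq_mul]; ring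
      _ ≤ ∫ η in Metric.ball (η₁ + v) (r / 2), g₁ η * g₂ (ξ - η) := by
          refine setIntegral_mono_on (integrableOn_const measure_ball_lt_top.ne)
            (hint ξ).integrableOn measurableSet_ball fun η hη ↦ ?_
          rw [Metric.mem_ball, dist_eq_norm] at hη
          refine mul_le_mul (hl₁ η ?_) (hl₂ _ ?_) hα₂ (hp₁ _)
          · rw [Metric.mem_ball, dist_eq_norm]
            have := norm_add_le (η - (η₁ + v)) v
            rw [show η - (η₁ + v) + v = η - η₁ by abel] at this
            linarith
          · rw [Metric.mem_ball, dist_eq_norm]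
            have := norm_sub_le v (η - (η₁ + v))
            rw [show v - (η - (η₁ + v)) = ξ - η - η₂ by rw [hξv]; abel] at this
            linarith
      _ ≤ ∫ η, g₁ η * g₂ (ξ - η) :=
          setIntegral_le_integral (hint ξ)
            (Eventually.of_forall fun η ↦ mul_nonneg (hp₁ _) (hp₂ _))

/-- The resonance: the conjugated factors contribute −2η, and (η − 2η) + (η − 2η) + 2η = 0. All
contributions are nonnegative, so nothing cancels. -/
theorem MinorizedOn.nonlin {f : FreqSpace d} {η : Space d} {r α : ℝ} (hr : 0 < r) (hα : 0 ≤ α)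
    (h₁ : MinorizedOn f η r α) (h₂ : MinorizedOn f ((2 : ℝ) • η) r α) :
    MinorizedOn (nonlin f) 0 r (α ^ 5 * ((r / 2) ^ d * ballVol d) ^ 4) := by
  have hv : 0 ≤ (r / 2) ^ d * ballVol d := mul_nonneg (by positivity) ballVol_pos.le
  have h₃ := MinorizedOn.conv hr hα h₁ h₂.refl
  have h₄ := MinorizedOn.conv hr (by positivity) h₃ h₃
  have h₅ := MinorizedOn.conv hr hα h₄ h₂
  have e₁ : η + -((2 : ℝ) • η) + (η + -((2 : ℝ) • η)) + (2 : ℝ) • η = 0 := by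
    rw [two_smul]; abel
  rw [e₁] at h₅
  have e₂ : ∀ V : ℝ, α ^ 5 * V ^ 4 = α * α * V * (α * α * V) * V * α * V := fun V ↦ by ring
  rw [e₂]
  exact h₅

/-! ### The data -/

/-- The tent of height one and radius `A` around `η`. -/
noncomputable def tent {A : ℝ} (hA : 0 < A) (η : Space d) : FreqSpace d :=
  ofCompactSupport (fun ξ ↦ ((max 0 (1 - ‖ξ - η‖ / A) : ℝ) : ℂ)) (by fun_prop)
    (HasCompactSupport.intro (isCompact_closedBall η A) fun ξ hξ ↦ by
      rw [Metric.mem_closedBall, dist_eq_norm, not_le] at hξ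
      rw [max_eq_left, Complex.ofReal_zero]
      rw [sub_nonpos, le_div_iff₀ hA]
      linarith)

theorem tent_apply {A : ℝ} (hA : 0 < A) (η ξ : Space d) :
    tent hA η ξ = ((max 0 (1 - ‖ξ - η‖ / A) : ℝ) : ℂ) := rfl

theorem tent_eq_zero {A : ℝ} (hA : 0 < A) {η ξ : Space d} (h : A ≤ ‖ξ - η‖) : tent hA η ξ = 0 := by
  rw [tent_apply, max_eq_left, Complex.ofReal_zero]
  rw [sub_nonpos, le_div_iff₀ hA]
  linarith

theorem norm_tent_le {A : ℝ} (hA : 0 < A) (η ξ : Space d) : ‖tent hA η ξ‖ ≤ 1 := by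
  rw [tent_apply, Complex.norm_real, Real.norm_of_nonneg (le_max_left _ _)]
  exact max_le zero_le_one (sub_le_self _ (by positivity))

theorem l1Norm_le_of_support {f : FreqSpace d} {η : Space d} {A C : ℝ} (hA : 0 < A)
    (h₀ : ∀ ξ, A ≤ ‖ξ - η‖ → f ξ = 0) (hC : ∀ ξ, ‖f ξ‖ ≤ C) :
    f.l1Norm ≤ C * (A ^ d * ballVol d) := by
  rw [l1Norm_eq, ← setIntegral_eq_integral_of_forall_compl_eq_zero (s := Metric.ball η A),
    ← volume_real_ball η hA]
  · refine (setIntegral_mono f.integrable.norm.integrableOn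
      (integrableOn_const measure_ball_lt_top.ne) hC).trans_eq ?_
    rw [setIntegral_const, smul_eq_mul, mul_comm]
  · intro ξ hξ
    rw [Metric.mem_ball, dist_eq_norm, not_lt] at hξ
    rw [h₀ ξ hξ, norm_zero]

/-- The data concentrated around the frequencies `η` and `2η`. -/
noncomputable def twoTents (R : ℝ) {A : ℝ} (hA : 0 < A) (η : Space d) : FreqSpace d :=
  (R : ℂ) • (tent hA η + tent hA ((2 : ℝ) • η))

theorem norm_twoTents_apply_le {R A : ℝ} (hR : 0 ≤ R) (hA : 0 < A) (η ξ : Space d) :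
    ‖twoTents R hA η ξ‖ ≤ 2 * R := by
  rw [twoTents, smul_apply, add_apply, norm_mul, Complex.norm_real, Real.norm_of_nonneg hR,
    mul_comm]
  refine mul_le_mul_of_nonneg_right ((norm_add_le _ _).trans ?_) hR
  linarith [norm_tent_le hA η ξ, norm_tent_le hA ((2 : ℝ) • η) ξ]

theorem supNorm_twoTents_le {R A : ℝ} (hR : 0 ≤ R) (hA : 0 < A) (η : Space d) :
    (twoTents R hA η).supNorm ≤ 2 * R :=
  supNorm_le (by positivity) (norm_twoTents_apply_le hR hA η)

theorem l1Norm_twoTents_le {R A : ℝ} (hR : 0 ≤ R) (hA : 0 < A) (η : Space d) :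
    (twoTents R hA η).l1Norm ≤ 2 * ballVol d * (R * A ^ d) := by
  have h := fun ζ : Space d ↦ l1Norm_le_of_support (f := tent hA ζ) hA (fun ξ ↦ tent_eq_zero hA)
    (norm_tent_le hA ζ)
  rw [twoTents, l1Norm_smul, Complex.norm_real, Real.norm_of_nonneg hR]
  refine (mul_le_mul_of_nonneg_left ((l1Norm_add_le _ _).trans
    (add_le_add (h η) (h ((2 : ℝ) • η)))) hR).trans_eq (by ring)

theorem minorizedOn_twoTents {R A : ℝ} (hR : 0 ≤ R) (hA : 0 < A) (η : Space d) :
    MinorizedOn (twoTents R hA η) η (A / 2) (R / 2) ∧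
      MinorizedOn (twoTents R hA η) ((2 : ℝ) • η) (A / 2) (R / 2) := by
  have hpos : ∀ ζ ξ : Space d, 0 ≤ max 0 (1 - ‖ξ - ζ‖ / A) := fun _ _ ↦ le_max_left _ _
  have hhalf : ∀ ζ : Space d, ∀ ξ ∈ Metric.ball ζ (A / 2), 1 / 2 ≤ max 0 (1 - ‖ξ - ζ‖ / A) := by
    intro ζ ξ hξ
    rw [Metric.mem_ball, dist_eq_norm] at hξ
    refine le_max_of_le_right ?_
    rw [le_sub_comm, div_le_iff₀ hA]
    linarith
  have hform : ∀ ξ, twoTents R hA η ξ =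
      ((R * (max 0 (1 - ‖ξ - η‖ / A) + max 0 (1 - ‖ξ - (2 : ℝ) • η‖ / A)) : ℝ) : ℂ) := by
    intro ξ
    rw [twoTents, smul_apply, add_apply, tent_apply, tent_apply]
    push_cast
    rfl
  refine ⟨⟨_, hform, fun ξ ↦ mul_nonneg hR (add_nonneg (hpos _ _) (hpos _ _)), fun ξ hξ ↦ ?_⟩,
    ⟨_, hform, fun ξ ↦ mul_nonneg hR (add_nonneg (hpos _ _) (hpos _ _)), fun ξ hξ ↦ ?_⟩⟩
  · nlinarith [hpos ((2 : ℝ) • η) ξ, hhalf η ξ hξ]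
  · nlinarith [hpos η ξ, hhalf _ ξ hξ]

theorem twoTents_eq_zero (R : ℝ) {A : ℝ} (hA : 0 < A) {η ξ : Space d} (h₁ : A ≤ ‖ξ - η‖)
    (h₂ : A ≤ ‖ξ - (2 : ℝ) • η‖) : twoTents R hA η ξ = 0 := by
  rw [twoTents, smul_apply, add_apply, tent_eq_zero hA h₁, tent_eq_zero hA h₂]
  simp



/-! ### Growth at low frequencies -/

theorem symbol_le_of_norm_le {ξ : Space d} {N : ℝ} (h : ‖ξ‖ ≤ 3 * N) :
    symbol ξ ≤ (6 * Real.pi) ^ 4 * N ^ 4 := by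
  rw [symbol, ← mul_pow]
  have := Real.pi_pos
  refine pow_le_pow_left₀ (by positivity) ?_ 4
  nlinarith

set_option maxHeartbeats 1000000 in
/-- Adding the two tents to the data `ψ` changes the solution at time `δ / N⁴` by a definite amount
at all low frequencies. -/
theorem exists_growth (d : ℕ) : ∃ δ κ : ℝ, 0 < δ ∧ 0 < κ ∧ ∀ (μ : ℝ), |μ| = 1 →
    ∀ (N A R : ℝ) (hA : 0 < A) (η : Space d) (ψ : FreqSpace d), ‖η‖ = N → 1 ≤ A → 4 * A ≤ N →
      0 < R → R * A ^ d ≤ N → ‖ψ‖ ≤ δ * (R * A ^ d) →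
      ∃ w b : ℝ → FreqSpace d, w 0 = ψ + twoTents R hA η ∧ IsProfile μ (δ / N ^ 4) w ∧
        (b (δ / N ^ 4)).supNorm ≤ 2 * ‖ψ‖ ∧ (b (δ / N ^ 4)).l1Norm ≤ 2 * ‖ψ‖ ∧
        ∀ ξ ∈ Metric.ball (0 : Space d) (A / 2),
          κ * (R * A ^ d / N) ^ 4 * R ≤ ‖(w (δ / N ^ 4) - b (δ / N ^ 4)) ξ‖ := by
  have hv := ballVol_pos (d := d)
  set v := ballVol d with hvdef
  -- In units of X = R A^d, `C` bounds the data: 2v + 2 for the tents and 1 for ψ. `c₁` comes from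
  -- `MinorizedOn.nonlin` with height R/2 and radius A/2, and `L` from the symbol on |ξ| ≤ 3N. `D`
  -- is the error constant for M = 4CX, K = 2R and P = 2‖ψ‖.
  obtain ⟨C, hC⟩ : ∃ C : ℝ, C = 2 * v + 3 := ⟨_, rfl⟩
  obtain ⟨c₁, hc₁⟩ : ∃ c : ℝ, c = (1 / 2) ^ 5 * ((1 / 4) ^ d * v) ^ 4 := ⟨_, rfl⟩
  obtain ⟨L, hL⟩ : ∃ L : ℝ, L = (6 * Real.pi) ^ 4 := ⟨_, rfl⟩
  obtain ⟨D, hD⟩ : ∃ D : ℝ, D = 2 * (4 * C) ^ 3 * (32 + 50 * (4 * C) ^ 5 + 11 * L * (4 * C)) :=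
    ⟨_, rfl⟩
  have hCpos : 0 < C := by rw [hC]; positivity
  have hc₁pos : 0 < c₁ := by rw [hc₁]; positivity
  have hLpos : 0 < L := by rw [hL]; have := Real.pi_pos; positivity
  have hDpos : 0 < D := by rw [hD]; positivity
  -- The entries of the minimum ensure, in order, ‖ψ‖ ≤ X, a time short enough for existence and
  -- comparison, and an error of at most half the main term.
  obtain ⟨δ, hδ⟩ : ∃ δ : ℝ, δ = min 1 (min (1 / (10 * (4 * C) ^ 4)) (c₁ / (2 * D))) := ⟨_, rfl⟩
  have hδpos : 0 < δ := by
    rw [hδ]; exact lt_min one_pos (lt_min (by positivity) (by positivity))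
  have hδ₁ : δ ≤ 1 := by rw [hδ]; exact min_le_left _ _
  have hδC : 10 * (4 * C) ^ 4 * δ ≤ 1 := by
    have h : δ ≤ 1 / (10 * (4 * C) ^ 4) := by
      rw [hδ]; exact (min_le_right _ _).trans (min_le_left _ _)
    rw [le_div_iff₀ (by positivity)] at h
    linarith
  have hδD : δ * D ≤ c₁ / 2 := by
    have h : δ ≤ c₁ / (2 * D) := by
      rw [hδ]; exact (min_le_right _ _).trans (min_le_right _ _)
    rw [le_div_iff₀ (by positivity)] at h
    linarith
  refine ⟨δ, δ * (c₁ / 2), hδpos, by positivity, ?_⟩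
  intro μ hμ N A R hA η ψ hη hA₁ hAN hR hXN hψ
  have hN : 0 < N := by linarith
  obtain ⟨X, hX⟩ : ∃ X, X = R * A ^ d := ⟨_, rfl⟩
  obtain ⟨T, hT⟩ : ∃ T, T = δ / N ^ 4 := ⟨_, rfl⟩
  rw [← hX] at hXN hψ ⊢
  rw [← hT]
  have hXpos : 0 < X := by rw [hX]; positivity
  have hTpos : 0 < T := by rw [hT]; positivity
  have hTN : T * N ^ 4 = δ := by rw [hT]; field_simp
  have hTX : T * X ^ 4 ≤ δ := by
    rw [← hTN]; gcongr
  have hRX : R ≤ X := by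
    rw [hX]; exact le_mul_of_one_le_right hR.le (one_le_pow₀ hA₁)
  set φ := twoTents R hA η with hφ
  have hφsup : φ.supNorm ≤ 2 * R := supNorm_twoTents_le hR.le hA η
  have hφl1 : φ.l1Norm ≤ 2 * v * X := by rw [hX]; exact l1Norm_twoTents_le hR.le hA η
  have hψX : ‖ψ‖ ≤ X := hψ.trans (by nlinarith)
  have hφn : ‖φ‖ ≤ (2 * v + 2) * X := by
    rw [norm_eq]
    refine max_le (hφsup.trans ?_) (hφl1.trans ?_) <;> nlinarith
  have hw₀ : ‖ψ + φ‖ ≤ C * X := by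
    refine (norm_add_le _ _).trans ?_
    rw [hC]; linarith
  have hsmall : 10 * (T * (4 * C * X) ^ 4) ≤ 1 := by
    have : 10 * (4 * C) ^ 4 * (T * X ^ 4) ≤ 10 * (4 * C) ^ 4 * δ := by gcongr
    calc _ = 10 * (4 * C) ^ 4 * (T * X ^ 4) := by ring
      _ ≤ 1 := this.trans hδC
  have hsmall' : 32 * (T * (C * X) ^ 4) ≤ 1 := by
    have h : 0 ≤ T * (C * X) ^ 4 := by positivity
    nlinarith
  obtain ⟨w, hw0, hw, hwn⟩ := exists_isProfile hμ (by positivity) hTpos.le hw₀ hsmall'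
  obtain ⟨b, hb0, hb, hbn⟩ := exists_isProfile hμ (norm_nonneg ψ) hTpos.le (le_refl ‖ψ‖)
    (T := T) (by
      refine le_trans ?_ hsmall'
      have : ‖ψ‖ ≤ C * X := hψX.trans (by rw [hC]; nlinarith)
      gcongr)
  have hTmem : T ∈ Icc 0 T := right_mem_Icc.2 hTpos.le
  refine ⟨w, b, hw0, hw, (supNorm_le_norm _).trans (hbn T hTmem),
    (l1Norm_le_norm _).trans (hbn T hTmem), fun ξ hξ ↦ ?_⟩
  rw [Metric.mem_ball, dist_zero_right] at hξ
  have hwb : w 0 - b 0 = φ := by rw [hw0, hb0, add_sub_cancel_left]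
  have hCX : 2 * ‖ψ‖ ≤ 2 * (C * X) := by
    have : ‖ψ‖ ≤ C * X := hψX.trans (by rw [hC]; nlinarith)
    linarith
  -- Each solution is at most 2CX, so M = 4CX also covers their difference. The tents live in |ξ| ≤
  -- 2N + A ≤ 3N.
  have hmain := norm_sub_sub_nonlin_le hμ hTpos.le hw hb (M := 4 * C * X) (P := 2 * ‖ψ‖)
    (K := 2 * R) (Λ := L * N ^ 4)
    (fun t ht ↦ ((l1Norm_le_norm _).trans (hwn t ht)).trans (by nlinarith))
    (fun t ht ↦ (l1Norm_le_norm _).trans (hbn t ht)) (by nlinarith)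
    (fun t ht ↦ ((l1Norm_le_norm _).trans (norm_sub_le _ _)).trans
      (by linarith [hwn t ht, hbn t ht])) hsmall (by rw [hwb]; exact hφsup)
    (fun ζ hζ ↦ by
      rw [hL]
      refine symbol_le_of_norm_le ?_
      rw [hwb] at hζ
      by_contra hlt
      rw [not_le] at hlt
      refine hζ (twoTents_eq_zero R hA ?_ ?_)
      · have := norm_sub_norm_le ζ η
        linarith
      · have := norm_sub_norm_le ζ ((2 : ℝ) • η)
        rw [norm_smul, Real.norm_of_nonneg (by norm_num), hη] at this
        linarith)
    (ξ := ξ) (by rw [hL]; exact symbol_le_of_norm_le (by linarith))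
  -- The tents do not reach |ξ| < A/2, so the linear part contributes nothing there.
  have hφξ : φ ξ = 0 := by
    refine twoTents_eq_zero R hA ?_ ?_
    · have := norm_sub_norm_le η ξ
      rw [norm_sub_rev] at this
      linarith
    · have := norm_sub_norm_le ((2 : ℝ) • η) ξ
      rw [norm_smul, Real.norm_of_nonneg (by norm_num), hη, norm_sub_rev] at this
      linarith
  rw [hwb, hφξ, sub_zero] at hmain
  have hlow : T * (c₁ * (R * X ^ 4)) ≤ ‖(T : ℂ) * ((μ : ℂ) * Complex.I * nonlin φ ξ)‖ := by
    rw [norm_mul, norm_mul, norm_coeff hμ, one_mul, Complex.norm_real, Real.norm_of_nonneg hTpos.le]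
    refine mul_le_mul_of_nonneg_left ?_ hTpos.le
    have h := minorizedOn_twoTents hR.le hA η
    have h' := (MinorizedOn.nonlin (by positivity) (by positivity) h.1 h.2).le_norm (ξ := ξ)
      (by rwa [Metric.mem_ball, dist_zero_right])
    refine le_of_eq_of_le ?_ h'
    rw [hc₁, hX, ← hvdef, show A / 2 / 2 = 1 / 4 * A by ring, mul_pow (1 / 4 : ℝ) A d]
    ring
  -- Each error gains δX: the first from ‖ψ‖ ≤ δX, the second from T X⁴ ≤ δ, the third from T N⁴ =
  -- δ.
  have herr : 2 * R * (4 * C * X) ^ 3 * (16 * (2 * ‖ψ‖) + 50 * (T * (4 * C * X) ^ 5) +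
      11 * (T * (L * N ^ 4) * (4 * C * X))) * T ≤ T * (c₁ / 2 * (R * X ^ 4)) := by
    have h₁ : 16 * (2 * ‖ψ‖) + 50 * (T * (4 * C * X) ^ 5) + 11 * (T * (L * N ^ 4) * (4 * C * X)) ≤
        δ * X * (32 + 50 * (4 * C) ^ 5 + 11 * L * (4 * C)) := by
      have e₁ : T * (4 * C * X) ^ 5 = (T * X ^ 4) * ((4 * C) ^ 5 * X) := by ring
      have e₂ : T * (L * N ^ 4) * (4 * C * X) = (T * N ^ 4) * (L * (4 * C) * X) := by ring
      rw [e₁, e₂, hTN]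
      have := mul_le_mul_of_nonneg_right hTX (by positivity : 0 ≤ (4 * C) ^ 5 * X)
      linarith
    calc _ ≤ 2 * R * (4 * C * X) ^ 3 * (δ * X * (32 + 50 * (4 * C) ^ 5 + 11 * L * (4 * C))) * T := by
          gcongr
      _ = T * (δ * D * (R * X ^ 4)) := by rw [hD]; ring
      _ ≤ _ := by gcongr
  have htri : ‖(T : ℂ) * ((μ : ℂ) * Complex.I * nonlin φ ξ)‖ ≤ ‖(w T - b T) ξ‖ +
      ‖(w T - b T) ξ - T * ((μ : ℂ) * Complex.I * nonlin φ ξ)‖ := by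
    have := norm_sub_le ((w T - b T) ξ) ((w T - b T) ξ - T * ((μ : ℂ) * Complex.I * nonlin φ ξ))
    rwa [sub_sub_cancel] at this
  have hgoal : δ * (c₁ / 2) * (X / N) ^ 4 * R = T * (c₁ / 2 * (R * X ^ 4)) := by
    rw [hT, div_pow]; ring
  rw [hgoal]
  linarith

end FreqSpace
theorem toDistribution_apply {d : ℕ} (f : Space d →ᵇ ℂ) (φ : 𝓢(Space d, ℂ)) :
    toDistribution f φ = ∫ x, φ x * f x := by
  rw [toDistribution, Lp.toTemperedDistribution_apply]
  refine integral_congr_ae ?_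
  filter_upwards [(f.memLp_top (μ := volume)).coeFn_toLp] with x hx
  rw [hx, smul_eq_mul]

namespace FreqSpace

variable {d : ℕ}

/-! ### Physical space -/

/-- The bounded continuous function with Fourier transform `f`. -/
noncomputable def toPhys (f : FreqSpace d) : Space d →ᵇ ℂ :=
  BoundedContinuousFunction.ofNormedAddCommGroup (𝓕⁻ (f : Space d → ℂ))
    (VectorFourier.fourierIntegral_continuous Real.continuous_fourierChar
      (L := -innerₗ (Space d)) (by
        simp only [LinearMap.neg_apply, innerₗ_apply_apply]; fun_prop) f.integrable)
    f.l1Norm (fun x ↦ by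
      rw [l1Norm_eq]
      exact VectorFourier.norm_fourierIntegral_le_integral_norm _ _ _ _ _)

theorem toPhys_apply (f : FreqSpace d) (x : Space d) : toPhys f x = 𝓕⁻ (f : Space d → ℂ) x := rfl

theorem toPhys_sub (f g : FreqSpace d) : toPhys (f - g) = toPhys f - toPhys g := by
  ext x
  rw [BoundedContinuousFunction.sub_apply]
  simp only [toPhys_apply, Real.fourierInv_eq, sub_apply, smul_sub]
  exact integral_sub ((Real.fourierIntegral_convergent_iff (-x)).2 f.integrable |>.congr (by simp))
    ((Real.fourierIntegral_convergent_iff (-x)).2 g.integrable |>.congr (by simp))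

theorem toPhys_conv (f g : FreqSpace d) : toPhys (conv f g) = toPhys f * toPhys g := by
  ext x
  rw [BoundedContinuousFunction.mul_apply]
  simp only [toPhys_apply, Real.fourierInv_eq_fourier_neg, coe_conv]
  exact Real.fourier_mul_convolution_eq f.integrable g.integrable (-x)

theorem toPhys_refl (f : FreqSpace d) (x : Space d) :
    toPhys (refl f) x = (starRingEnd ℂ) (toPhys f x) := by
  simp only [toPhys_apply, Real.fourierInv_eq, refl_apply]
  rw [← integral_conj, ← integral_neg_eq_self]
  refine integral_congr_ae (Eventually.of_forall fun ξ ↦ ?_)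
  simp [Circle.smul_def, AddChar.map_neg_eq_inv]

theorem quintic_toPhys (f : FreqSpace d) : quintic (toPhys f) = toPhys (nonlin f) := by
  ext x
  simp only [nonlin, quint, toPhys_conv, BoundedContinuousFunction.mul_apply, toPhys_refl]
  change ((‖toPhys f x‖ ^ 4 : ℝ) : ℂ) * toPhys f x = _
  have h := Complex.mul_conj' (toPhys f x)
  rw [h]
  push_cast
  ring

/-- Fubini moves the inverse transform onto the Schwartz function. The form `-innerₗ` encodes 𝓕⁻ and
is symmetric, so flipping it changes nothing. -/
theorem toDistribution_toPhys_apply (f : FreqSpace d) (φ : 𝓢(Space d, ℂ)) :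
    toDistribution (toPhys f) φ = ∫ ξ, (𝓕⁻ φ) ξ * f ξ := by
  rw [toDistribution_apply]
  have h := VectorFourier.integral_fourierIntegral_smul_eq_flip (μ := volume) (ν := volume)
    (L := -innerₗ (Space d)) (f := φ) (g := f) Real.continuous_fourierChar
    (by simp only [LinearMap.neg_apply, innerₗ_apply_apply]; fun_prop) φ.integrable f.integrable
  have hflip : (-innerₗ (Space d)).flip = -innerₗ (Space d) := by
    ext x y; simp [real_inner_comm]
  rw [hflip] at h
  simp only [smul_eq_mul] at h
  rw [SchwartzMap.fourierInv_coe]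
  exact h.symm

theorem toDistribution_sub (f g : Space d →ᵇ ℂ) :
    toDistribution (f - g) = toDistribution f - toDistribution g := by
  rw [toDistribution, toDistribution, toDistribution, ← Lp.toTemperedDistributionCLM_apply,
    ← Lp.toTemperedDistributionCLM_apply, ← Lp.toTemperedDistributionCLM_apply, ← map_sub]
  rfl

theorem toDistribution_toPhys_sub (f g : FreqSpace d) :
    toDistribution (toPhys f) - toDistribution (toPhys g) = toDistribution (toPhys (f - g)) := by
  rw [toPhys_sub, toDistribution_sub]

theorem fourier_toDistribution_toPhys_apply (f : FreqSpace d) (φ : 𝓢(Space d, ℂ)) :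
    𝓕 (toDistribution (toPhys f)) φ = ∫ ξ, φ ξ * f ξ := by
  rw [TemperedDistribution.fourier_apply, toDistribution_toPhys_apply]
  simp

/-! ### The equation -/

theorem fourierInv_laplacian (φ : 𝓢(Space d, ℂ)) (ξ : Space d) :
    (𝓕⁻ (Δ φ)) ξ = ((-(2 * Real.pi * ‖ξ‖) ^ 2 : ℝ) : ℂ) * (𝓕⁻ φ) ξ := by
  have h : ∀ ψ : 𝓢(Space d, ℂ), (𝓕⁻ ψ) ξ = (𝓕 ψ) (-ξ) := fun ψ ↦ by
    rw [SchwartzMap.fourierInv_coe, SchwartzMap.fourier_coe, Real.fourierInv_eq_fourier_neg]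
  have hg : (fun ξ : Space d ↦ ‖ξ‖ ^ 2).HasTemperateGrowth := by fun_prop
  rw [h, h, SchwartzMap.laplacian_eq_fourierMultiplierCLM, SchwartzMap.fourierMultiplierCLM_apply,
    FourierTransform.fourier_smul, FourierTransform.fourier_fourierInv_eq, _root_.smul_apply]
  erw [SchwartzMap.smulLeftCLM_apply_apply hg]
  simp only [norm_neg, Complex.real_smul]
  push_cast
  ring

theorem fourierInv_laplacian_laplacian (φ : 𝓢(Space d, ℂ)) (ξ : Space d) :
    (𝓕⁻ (Δ (Δ φ))) ξ = (symbol ξ : ℂ) * (𝓕⁻ φ) ξ := by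
  rw [fourierInv_laplacian, fourierInv_laplacian, symbol]
  push_cast
  ring

/-- The pairing of bounded continuous functions with `C₀ ∩ L¹`. -/
noncomputable def pairing (d : ℕ) : (Space d →ᵇ ℂ) →L[ℂ] FreqSpace d →L[ℂ] ℂ :=
  LinearMap.mkContinuous₂
    (LinearMap.mk₂ ℂ (fun k f ↦ ∫ ξ, k ξ * f ξ)
      (fun k₁ k₂ f ↦ by
        simp only [BoundedContinuousFunction.add_apply, add_mul]
        exact integral_add (f.integrable.bdd_mul k₁.continuous.aestronglyMeasurable
          (Eventually.of_forall k₁.norm_coe_le_norm)) (f.integrable.bdd_mul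
            k₂.continuous.aestronglyMeasurable (Eventually.of_forall k₂.norm_coe_le_norm)))
      (fun c k f ↦ by
        simp only [BoundedContinuousFunction.smul_apply, smul_eq_mul, mul_assoc]
        exact integral_const_mul _ _)
      (fun k f g ↦ by
        simp only [add_apply, mul_add]
        exact integral_add (f.integrable.bdd_mul k.continuous.aestronglyMeasurable
          (Eventually.of_forall k.norm_coe_le_norm)) (g.integrable.bdd_mul
            k.continuous.aestronglyMeasurable (Eventually.of_forall k.norm_coe_le_norm)))
      (fun c k f ↦ by
        simp only [smul_apply, smul_eq_mul, mul_left_comm _ c]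
        exact integral_const_mul _ _))
    1 (fun k f ↦ by
      rw [one_mul]
      refine le_trans ?_ (mul_le_mul_of_nonneg_left f.l1Norm_le_norm (norm_nonneg k))
      rw [l1Norm_eq, ← integral_const_mul]
      refine norm_integral_le_of_norm_le (f.integrable.norm.const_mul _)
        (Eventually.of_forall fun ξ ↦ ?_)
      rw [norm_mul]
      exact mul_le_mul_of_nonneg_right (k.norm_coe_le_norm ξ) (norm_nonneg _))

theorem pairing_apply (k : Space d →ᵇ ℂ) (f : FreqSpace d) :
    pairing d k f = ∫ ξ, k ξ * f ξ := rfl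

theorem exists_norm_symbol_pow_mul_le (χ : 𝓢(Space d, ℂ)) (n : ℕ) :
    ∃ C, 0 ≤ C ∧ ∀ ξ, ‖(symbol ξ : ℂ) ^ n * χ ξ‖ ≤ C := by
  refine ⟨(2 * Real.pi) ^ (4 * n) * SchwartzMap.seminorm ℂ (4 * n) 0 χ, ?_, fun ξ ↦ ?_⟩
  · have := Real.pi_pos; positivity
  · rw [norm_mul, norm_pow, Complex.norm_real, Real.norm_of_nonneg (symbol_nonneg ξ), symbol,
      ← pow_mul, mul_pow, mul_assoc]
    have := Real.pi_pos
    gcongr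
    exact SchwartzMap.norm_pow_mul_le_seminorm ℂ χ (4 * n) ξ

theorem continuous_symbol_pow_mul (χ : 𝓢(Space d, ℂ)) (n : ℕ) :
    Continuous fun ξ ↦ (symbol ξ : ℂ) ^ n * χ ξ :=
  ((Complex.continuous_ofReal.comp continuous_symbol).pow n).mul χ.continuous

/-- The function `symbolⁿ · χ · phase` for a Schwartz function `χ`. -/
noncomputable def phasedTest (χ : 𝓢(Space d, ℂ)) (n : ℕ) (t : ℝ) : Space d →ᵇ ℂ :=
  BoundedContinuousFunction.ofNormedAddCommGroup (fun ξ ↦ (symbol ξ : ℂ) ^ n * χ ξ * phase t ξ)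
    ((continuous_symbol_pow_mul χ n).mul (continuous_phase t))
    (exists_norm_symbol_pow_mul_le χ n).choose
    (fun ξ ↦ by
      rw [norm_mul, norm_phase, mul_one]
      exact (exists_norm_symbol_pow_mul_le χ n).choose_spec.2 ξ)

theorem phasedTest_apply (χ : 𝓢(Space d, ℂ)) (n : ℕ) (t : ℝ) (ξ : Space d) :
    phasedTest χ n t ξ = (symbol ξ : ℂ) ^ n * χ ξ * phase t ξ := rfl

theorem _root_.Complex.norm_exp_ofReal_mul_I_sub_one_sub_le (x : ℝ) :
    ‖Complex.exp (x * Complex.I) - 1 - x * Complex.I‖ ≤ 3 * x ^ 2 := by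
  have hx : ‖(x : ℂ) * Complex.I‖ = |x| := by simp
  rcases le_or_gt |x| 1 with h | h
  · refine (Complex.norm_exp_sub_one_sub_id_le (by rwa [hx])).trans ?_
    rw [hx, sq_abs]
    nlinarith [sq_nonneg x]
  · refine (norm_sub_le _ _).trans ?_
    rw [hx]
    have h₁ : ‖Complex.exp (x * Complex.I) - 1‖ ≤ |x| := by
      rw [mul_comm]; exact Real.norm_exp_I_mul_ofReal_sub_one_le
    nlinarith [sq_abs x]

/-- The time derivative of the free evolution falls on the test function, since `evol t` is not
differentiable on all of `FreqSpace d`. The Taylor remainder is quadratic in (r − t)·symbol, and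
symbol²·χ is bounded because χ is Schwartz. -/
theorem hasDerivAt_phasedTest (χ : 𝓢(Space d, ℂ)) (t : ℝ) :
    HasDerivAt (phasedTest χ 0) (Complex.I • phasedTest χ 1 t) t := by
  obtain ⟨C, hC, hCb⟩ := exists_norm_symbol_pow_mul_le χ 2
  rw [hasDerivAt_iff_isLittleO]
  refine Asymptotics.IsBigO.trans_isLittleO (g := fun r : ℝ ↦ (r - t) ^ 2) ?_ ?_
  · refine Asymptotics.IsBigO.of_bound (3 * C) (Eventually.of_forall fun r ↦ ?_)
    refine (BoundedContinuousFunction.norm_le (by positivity)).2 fun ξ ↦ ?_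
    have e : (phasedTest χ 0 r - phasedTest χ 0 t - (r - t) • Complex.I • phasedTest χ 1 t) ξ =
        χ ξ * (phase t ξ * (Complex.exp (((r - t) * symbol ξ : ℝ) * Complex.I) - 1 -
          ((r - t) * symbol ξ : ℝ) * Complex.I)) := by
      have h : phase r ξ = phase t ξ * Complex.exp (((r - t) * symbol ξ : ℝ) * Complex.I) := by
        rw [← phase, ← phase_add]; ring_nf
      simp only [BoundedContinuousFunction.sub_apply, BoundedContinuousFunction.smul_apply,
        phasedTest_apply, h, smul_eq_mul, Complex.real_smul]
      push_cast
      ring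
    rw [e, norm_mul, norm_mul, norm_phase, one_mul]
    refine (mul_le_mul_of_nonneg_left (Complex.norm_exp_ofReal_mul_I_sub_one_sub_le _)
      (norm_nonneg _)).trans ?_
    have h := hCb ξ
    rw [norm_mul, norm_pow, Complex.norm_real, Real.norm_of_nonneg (symbol_nonneg ξ)] at h
    rw [Real.norm_of_nonneg (sq_nonneg _)]
    calc ‖χ ξ‖ * (3 * ((r - t) * symbol ξ) ^ 2) =
        3 * (symbol ξ ^ 2 * ‖χ ξ‖) * (r - t) ^ 2 := by ring
      _ ≤ _ := by gcongr
  · have := (Asymptotics.isLittleO_pow_id (𝕜 := ℝ) (n := 2) one_lt_two).comp_tendsto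
      (k := fun r ↦ r - t) (l' := 𝓝 t) (by
        have : Continuous fun r : ℝ ↦ r - t := by fun_prop
        simpa using this.tendsto t)
    simpa using! this

/-- The solution in physical space belonging to a solution in the interaction picture. -/
noncomputable def solution (z : ℝ → FreqSpace d) (t : ℝ) : Space d →ᵇ ℂ := toPhys (evol t (z t))

theorem toDistribution_solution_apply (z : ℝ → FreqSpace d) (t : ℝ) (φ : 𝓢(Space d, ℂ)) :
    toDistribution (solution z t) φ = pairing d (phasedTest (𝓕⁻ φ) 0 t) (z t) := by
  rw [solution, toDistribution_toPhys_apply, pairing_apply]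
  simp only [phasedTest_apply, evol_apply, pow_zero, one_mul, mul_assoc]

/-- The product rule for `pairing`: differentiating the phase gives the bi-Laplacian, and
differentiating the profile gives the nonlinearity, whose two phases cancel. -/
theorem hasDerivWithinAt_toDistribution_solution {μ T : ℝ} {z : ℝ → FreqSpace d}
    (hz : IsProfile μ T z) {t : ℝ} (ht : t ∈ Icc 0 T) (φ : 𝓢(Space d, ℂ)) :
    HasDerivWithinAt (fun r ↦ toDistribution (solution z r) φ)
      ((Complex.I • Δ (Δ (toDistribution (solution z t))) +
        (Complex.I * μ) • toDistribution (quintic (solution z t))) φ) (Icc 0 T) t := by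
  have h := ContinuousLinearMap.hasDerivWithinAt_of_bilinear
    (B := (pairing d).bilinearRestrictScalars ℝ)
    (hasDerivAt_phasedTest (𝓕⁻ φ) t).hasDerivWithinAt (hz t ht)
  simp only [toDistribution_solution_apply]
  refine h.congr_deriv ?_
  simp only [ContinuousLinearMap.bilinearRestrictScalars_apply_apply]
  have e₁ : pairing d (phasedTest (𝓕⁻ φ) 0 t) (field μ t (z t)) =
      Complex.I * μ * toDistribution (quintic (solution z t)) φ := by
    rw [solution, quintic_toPhys, toDistribution_toPhys_apply, pairing_apply, ← integral_const_mul]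
    refine integral_congr_ae (Eventually.of_forall fun ξ ↦ ?_)
    have hp : phase t ξ * phase (-t) ξ = 1 := by rw [← phase_add]; simp
    simp only [phasedTest_apply, field, smul_apply, evol_apply, pow_zero, one_mul]
    linear_combination (𝓕⁻ φ) ξ * Complex.I * μ * nonlin (evol t (z t)) ξ * hp
  have e₂ : pairing d (Complex.I • phasedTest (𝓕⁻ φ) 1 t) (z t) =
      Complex.I * Δ (Δ (toDistribution (solution z t))) φ := by
    rw [TemperedDistribution.laplacian_apply_apply, TemperedDistribution.laplacian_apply_apply,
      solution, toDistribution_toPhys_apply, pairing_apply, ← integral_const_mul]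
    refine integral_congr_ae (Eventually.of_forall fun ξ ↦ ?_)
    simp only [phasedTest_apply, BoundedContinuousFunction.smul_apply, smul_eq_mul, pow_one,
      fourierInv_laplacian_laplacian, evol_apply]
    ring
  rw [e₁, e₂, add_comm]
  rfl

/-! ### Norms -/

/-- The weight `(1 + |ξ|²)^(s/2)`. -/
noncomputable def weight (s : ℝ) (ξ : Space d) : ℝ := (1 + ‖ξ‖ ^ 2) ^ (s / 2)

theorem weight_pos (s : ℝ) (ξ : Space d) : 0 < weight s ξ := by unfold weight; positivity

theorem weight_le_one {s : ℝ} (hs : s ≤ 0) (ξ : Space d) : weight s ξ ≤ 1 :=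
  Real.rpow_le_one_of_one_le_of_nonpos (by nlinarith [sq_nonneg ‖ξ‖]) (by linarith)

theorem continuous_weight (s : ℝ) : Continuous (weight (d := d) s) := by
  unfold weight
  refine Continuous.rpow_const (by fun_prop) fun ξ ↦ Or.inl ?_
  positivity

theorem hasTemperateGrowth_weight (s : ℝ) :
    (fun ξ : Space d ↦ (((1 + ‖ξ‖ ^ 2) ^ (s / 2) : ℝ) : ℂ)).HasTemperateGrowth := by fun_prop

theorem smulLeftCLM_fourier_toPhys {s : ℝ} {p : ℝ≥0∞} [Fact (1 ≤ p)] {f : FreqSpace d}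
    {g : Lp ℂ p (volume : Measure (Space d))}
    (hg : (g : Space d → ℂ) =ᵐ[volume] fun ξ ↦ (weight s ξ : ℂ) * f ξ) :
    smulLeftCLM ℂ (fun ξ : Space d ↦ (((1 + ‖ξ‖ ^ 2) ^ (s / 2) : ℝ) : ℂ))
      (𝓕 (toDistribution (toPhys f))) = (g : 𝓢'(Space d, ℂ)) := by
  ext φ
  rw [smulLeftCLM_apply_apply, fourier_toDistribution_toPhys_apply, Lp.toTemperedDistribution_apply]
  refine integral_congr_ae ?_
  filter_upwards [hg] with ξ hξ
  rw [hξ, SchwartzMap.smulLeftCLM_apply_apply (hasTemperateGrowth_weight s), smul_eq_mul,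
    smul_eq_mul, weight]
  ring

theorem fl1Norm_toPhys_le (f : FreqSpace d) :
    fl1Norm (toDistribution (toPhys f)) ≤ ENNReal.ofReal ‖f‖ := by
  refine (iInf₂_le (toL1 f) (smulLeftCLM_fourier_toPhys ?_)).trans ?_
  · filter_upwards [f.coe_ae] with ξ hξ
    rw [weight, zero_div, Real.rpow_zero, Complex.ofReal_one, one_mul]
    exact hξ
  · rw [← ofReal_norm]
    exact ENNReal.ofReal_le_ofReal f.l1Norm_le_norm

theorem eLpNorm_two_sq (g : Space d → ℂ) : eLpNorm g 2 volume ^ 2 = ∫⁻ ξ, ‖g ξ‖ₑ ^ 2 := by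
  simpa using eLpNorm_nnreal_pow_eq_lintegral (f := g) (μ := volume) (p := 2) two_ne_zero

/-- Interpolation: ‖f‖₂² is at most the supremum norm times the L¹ norm. Therefore `FreqSpace d`
embeds into H^s for s ≤ 0. -/
theorem eLpNorm_two_le (f : FreqSpace d) :
    eLpNorm (f : Space d → ℂ) 2 volume ≤ ENNReal.ofReal ‖f‖ := by
  have h₁ : eLpNorm (f : Space d → ℂ) 2 volume ^ 2 ≤ ENNReal.ofReal ‖f‖ ^ 2 := by
    have h₃ : ∫⁻ ξ, ‖f ξ‖ₑ = ENNReal.ofReal f.l1Norm := by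
      rw [l1Norm_eq, ofReal_integral_norm_eq_lintegral_enorm f.integrable]
    rw [eLpNorm_two_sq, sq]
    calc ∫⁻ ξ, ‖f ξ‖ₑ ^ 2 ≤ ∫⁻ ξ, ENNReal.ofReal ‖f‖ * ‖f ξ‖ₑ := by
          refine lintegral_mono fun ξ ↦ ?_
          rw [sq]
          gcongr
          rw [← ofReal_norm]
          exact ENNReal.ofReal_le_ofReal ((f.norm_apply_le ξ).trans f.supNorm_le_norm)
      _ = ENNReal.ofReal ‖f‖ * ENNReal.ofReal f.l1Norm := by
          rw [lintegral_const_mul' _ _ ENNReal.ofReal_ne_top, h₃]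
      _ ≤ _ := by gcongr; exact f.l1Norm_le_norm
  exact (ENNReal.pow_le_pow_left_iff two_ne_zero).1 h₁

/-- The function `⟨ξ⟩^s f`. -/
noncomputable def weighted (s : ℝ) (f : FreqSpace d) (ξ : Space d) : ℂ := (weight s ξ : ℂ) * f ξ

theorem continuous_weighted (s : ℝ) (f : FreqSpace d) : Continuous (weighted s f) :=
  (Complex.continuous_ofReal.comp (continuous_weight s)).mul f.continuous_coe

theorem eLpNorm_weighted_le {s : ℝ} (hs : s ≤ 0) (f : FreqSpace d) :
    eLpNorm (weighted s f) 2 volume ≤ ENNReal.ofReal ‖f‖ := by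
  refine (eLpNorm_mono fun ξ ↦ ?_).trans f.eLpNorm_two_le
  rw [weighted, norm_mul, Complex.norm_real, Real.norm_of_nonneg (weight_pos s ξ).le]
  exact mul_le_of_le_one_left (norm_nonneg _) (weight_le_one hs ξ)

theorem memLp_weighted {s : ℝ} (hs : s ≤ 0) (f : FreqSpace d) :
    MemLp (weighted s f) 2 volume :=
  ⟨(continuous_weighted s f).aestronglyMeasurable,
    (eLpNorm_weighted_le hs f).trans_lt ENNReal.ofReal_lt_top⟩

/-- L² functions inject into tempered distributions, so the infimum runs over a single
representative. -/
theorem sobolevNorm_eq_enorm {s : ℝ} {D : 𝓢'(Space d, ℂ)}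
    {g : Lp ℂ 2 (volume : Measure (Space d))}
    (h : smulLeftCLM ℂ (fun ξ : Space d ↦ (((1 + ‖ξ‖ ^ 2) ^ (s / 2) : ℝ) : ℂ)) (𝓕 D) =
      (g : 𝓢'(Space d, ℂ))) : sobolevNorm s D = ‖g‖ₑ := by
  refine le_antisymm (iInf₂_le g h) (le_iInf₂ fun g' h' ↦ le_of_eq ?_)
  have hinj := LinearMap.ker_eq_bot.1
    (Lp.ker_toTemperedDistributionCLM_eq_bot (F := ℂ) (μ := (volume : Measure (Space d))) (p := 2))
  have : g = g' := hinj (h.symm.trans h')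
  rw [this]

theorem sobolevNorm_toPhys {s : ℝ} (hs : s ≤ 0) (f : FreqSpace d) :
    sobolevNorm s (toDistribution (toPhys f)) = eLpNorm (weighted s f) 2 volume := by
  rw [sobolevNorm_eq_enorm (smulLeftCLM_fourier_toPhys (memLp_weighted hs f).coeFn_toLp),
    Lp.enorm_toLp]

/-- Both required norms are dominated by the norm of `FreqSpace d`, in which the evolved profile is
continuous. -/
theorem isSolution_solution {μ s T : ℝ} (hs : s ≤ 0) {z : ℝ → FreqSpace d}
    (hz : IsProfile μ T z) : IsSolution μ s T (solution z) := by
  have hcont : ContinuousOn (fun t ↦ evol t (z t)) (Icc 0 T) :=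
    continuousOn_id.evol hz.continuousOn
  have key : ∀ Nm : 𝓢'(Space d, ℂ) → ℝ≥0∞,
      (∀ f : FreqSpace d, Nm (toDistribution (toPhys f)) ≤ ENNReal.ofReal ‖f‖) →
      ContinuousInNorm Nm T (solution z) := by
    intro Nm hNm t ht
    refine ⟨(hNm _).trans_lt ENNReal.ofReal_lt_top, ?_⟩
    have h := tendsto_iff_norm_sub_tendsto_zero.1 (hcont t ht)
    have h' := (ENNReal.continuous_ofReal.tendsto 0).comp h
    rw [ENNReal.ofReal_zero] at h'
    refine tendsto_of_tendsto_of_tendsto_of_le_of_le tendsto_const_nhds h' (fun _ ↦ zero_le)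
      fun r ↦ ?_
    change Nm (toDistribution (toPhys _) - toDistribution (toPhys _)) ≤ _
    rw [toDistribution_toPhys_sub]
    exact hNm _
  refine ⟨key _ fl1Norm_toPhys_le, key _ fun f ↦ ?_, fun t ht ↦ ?_⟩
  · rw [sobolevNorm_toPhys hs]; exact eLpNorm_weighted_le hs f
  · refine ⟨_, hasDerivWithinAt_toDistribution_solution hz ht, ?_⟩
    rw [smul_add, smul_smul, smul_smul, ← mul_assoc, Complex.I_mul_I, neg_one_mul]
    simp only [neg_smul, one_smul]
    abel



/-! ### Sobolev norms of data and solutions -/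

/-- The square of the `L²` norm of `⟨ξ⟩^s` over the ball of radius `r`. -/
noncomputable def lowMass (d : ℕ) (s r : ℝ) : ℝ :=
  ∫ ξ in Metric.ball (0 : Space d) r, weight s ξ ^ 2

theorem integrableOn_weight_sq (s : ℝ) (x : Space d) (r : ℝ) :
    IntegrableOn (fun ξ ↦ weight s ξ ^ 2) (Metric.ball x r) :=
  (((continuous_weight s).pow 2).continuousOn.integrableOn_compact
    (isCompact_closedBall x r)).mono_set Metric.ball_subset_closedBall

theorem lowMass_nonneg (s r : ℝ) : 0 ≤ lowMass d s r := integral_nonneg fun _ ↦ sq_nonneg _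

theorem le_eLpNorm_weighted (s : ℝ) {f : FreqSpace d} {c r : ℝ} (hc : 0 ≤ c)
    (h : ∀ ξ ∈ Metric.ball (0 : Space d) r, c ≤ ‖f ξ‖) :
    ENNReal.ofReal (c * √(lowMass d s r)) ≤ eLpNorm (weighted s f) 2 volume := by
  refine (ENNReal.pow_le_pow_left_iff two_ne_zero).1 ?_
  rw [eLpNorm_two_sq, ← ENNReal.ofReal_pow (by positivity), mul_pow, Real.sq_sqrt (lowMass_nonneg s r),
    lowMass, ← integral_const_mul, ofReal_integral_eq_lintegral_ofReal
      ((integrableOn_weight_sq s 0 r).const_mul _) (Eventually.of_forall fun ξ ↦ by positivity)]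
  refine le_trans ?_ (setLIntegral_le_lintegral (Metric.ball (0 : Space d) r) _)
  refine setLIntegral_mono' measurableSet_ball fun ξ hξ ↦ ?_
  rw [← ofReal_norm, ← ENNReal.ofReal_pow (norm_nonneg _), weighted, norm_mul, Complex.norm_real,
    Real.norm_of_nonneg (weight_pos s ξ).le, mul_pow, mul_comm]
  refine ENNReal.ofReal_le_ofReal (mul_le_mul_of_nonneg_left ?_ (sq_nonneg _))
  exact pow_le_pow_left₀ hc (h ξ hξ) 2

/-- As 4A ≤ N, both balls lie in |ξ| ≥ N/2, where the weight is at most (N/2)^s. -/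
theorem eLpNorm_weighted_twoTents_le {s R A N : ℝ} (hs : s ≤ 0) (hR : 0 ≤ R) (hA : 0 < A)
    (hAN : 4 * A ≤ N) {η : Space d} (hη : ‖η‖ = N) :
    eLpNorm (weighted s (twoTents R hA η)) 2 volume ≤
      ENNReal.ofReal (2 * R * (N / 2) ^ s * √(2 * (A ^ d * ballVol d))) := by
  have hN : 0 < N := by linarith
  have hv := ballVol_pos (d := d)
  have hC : 0 ≤ 2 * R * (N / 2) ^ s := by positivity
  refine (ENNReal.pow_le_pow_left_iff two_ne_zero).1 ?_
  have hzero : ∀ ξ ∉ Metric.ball η A ∪ Metric.ball ((2 : ℝ) • η) A,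
      twoTents R hA η ξ = 0 := by
    intro ξ hξ
    simp only [mem_union, Metric.mem_ball, dist_eq_norm, not_or, not_lt] at hξ
    exact twoTents_eq_zero R hA hξ.1 hξ.2
  have hbound : ∀ ξ, ‖weighted s (twoTents R hA η) ξ‖ ≤ 2 * R * (N / 2) ^ s := by
    intro ξ
    by_cases hξ : twoTents R hA η ξ = 0
    · rw [weighted, hξ, mul_zero, norm_zero]; exact hC
    · have hmem : ξ ∈ Metric.ball η A ∪ Metric.ball ((2 : ℝ) • η) A := by
        by_contra hcon; exact hξ (hzero ξ hcon)
      have hξN : N / 2 ≤ ‖ξ‖ := by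
        simp only [mem_union, Metric.mem_ball, dist_eq_norm] at hmem
        rcases hmem with hm | hm
        · have := norm_sub_norm_le η ξ
          rw [norm_sub_rev] at this
          linarith
        · have := norm_sub_norm_le ((2 : ℝ) • η) ξ
          rw [norm_sub_rev, norm_smul, Real.norm_of_nonneg (by norm_num), hη] at this
          linarith
      rw [weighted, norm_mul, Complex.norm_real, Real.norm_of_nonneg (weight_pos s ξ).le, mul_comm]
      refine mul_le_mul (norm_twoTents_apply_le hR hA η ξ) ?_ (weight_pos s ξ).le (by positivity)
      have h₁ : (N / 2) ^ s = ((N / 2) ^ 2) ^ (s / 2) := by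
        rw [← Real.rpow_natCast, ← Real.rpow_mul (by positivity)]; congr 1; push_cast; ring
      rw [weight, h₁]
      refine Real.rpow_le_rpow_of_nonpos (by positivity) ?_ (by linarith)
      nlinarith
  have hvol : volume (Metric.ball η A ∪ Metric.ball ((2 : ℝ) • η) A) ≤
      ENNReal.ofReal (2 * (A ^ d * ballVol d)) := by
    refine (measure_union_le _ _).trans ?_
    rw [← ofReal_measureReal measure_ball_lt_top.ne, ← ofReal_measureReal measure_ball_lt_top.ne,
      volume_real_ball _ hA, volume_real_ball _ hA, ← ENNReal.ofReal_add (by positivity)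
        (by positivity), two_mul]
  rw [eLpNorm_two_sq, ← ENNReal.ofReal_pow (by positivity), mul_pow, Real.sq_sqrt (by positivity)]
  rw [← setLIntegral_eq_of_support_subset (s := Metric.ball η A ∪ Metric.ball ((2 : ℝ) • η) A)]
  · calc _ ≤ ∫⁻ _ in Metric.ball η A ∪ Metric.ball ((2 : ℝ) • η) A,
          ENNReal.ofReal ((2 * R * (N / 2) ^ s) ^ 2) := by
          refine lintegral_mono fun ξ ↦ ?_
          rw [← ofReal_norm, ← ENNReal.ofReal_pow (norm_nonneg _)]
          exact ENNReal.ofReal_le_ofReal (pow_le_pow_left₀ (norm_nonneg _) (hbound ξ) 2)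
      _ ≤ _ := by
          rw [setLIntegral_const, ENNReal.ofReal_mul (by positivity)]
          gcongr
  · intro ξ hξ
    by_contra hcon
    exact hξ (by simp [weighted, hzero ξ hcon])

theorem eLpNorm_weighted_evol (s t : ℝ) (f : FreqSpace d) :
    eLpNorm (weighted s (evol t f)) 2 volume = eLpNorm (weighted s f) 2 volume :=
  eLpNorm_congr_norm_ae (Eventually.of_forall fun ξ ↦ by simp [weighted])

theorem weighted_add (s : ℝ) (f g : FreqSpace d) : weighted s (f + g) = weighted s f + weighted s g := by
  ext ξ; simp [weighted, mul_add]

/-- Approximation of an element of `H^s` by functions whose Fourier transform is continuous with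
compact support. -/
theorem exists_approx {s : ℝ} (hs : s ≤ 0) {u₀ : 𝓢'(Space d, ℂ)} (hu₀ : MemSobolev s 2 u₀)
    {ε : ℝ} (hε : 0 < ε) : ∃ ψ : FreqSpace d, ∀ φ : FreqSpace d,
      sobolevNorm s (toDistribution (toPhys (ψ + φ)) - u₀) ≤
        ENNReal.ofReal ε + eLpNorm (weighted s φ) 2 volume := by
  obtain ⟨g, hg⟩ := memSobolev_iff_exists_smulLeftCLM_fourier.1 hu₀
  obtain ⟨h, hsupp, hle, hcont, -⟩ := (Lp.memLp g).exists_hasCompactSupport_eLpNorm_sub_le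
    (by norm_num) (ENNReal.ofReal_pos.2 hε).ne'
  have hwne : ∀ ξ : Space d, (weight s ξ : ℂ) ≠ 0 := fun ξ ↦ by
    exact_mod_cast (weight_pos s ξ).ne'
  -- h approximates the weighted transform of u₀ in L²; dividing by the weight keeps it continuous
  -- and compactly supported.
  have hψc : Continuous fun ξ : Space d ↦ (weight s ξ : ℂ)⁻¹ * h ξ :=
    ((Complex.continuous_ofReal.comp (continuous_weight s)).inv₀ hwne).mul hcont
  refine ⟨ofCompactSupport _ hψc hsupp.mul_left, fun φ ↦ ?_⟩
  set ψ := ofCompactSupport _ hψc hsupp.mul_left with hψ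
  have hψh : weighted s ψ = h := by
    ext ξ
    simp [weighted, hψ, hwne ξ]
  have hrep := smulLeftCLM_fourier_toPhys (memLp_weighted hs (ψ + φ)).coeFn_toLp
  have hfin : smulLeftCLM ℂ (fun ξ : Space d ↦ (((1 + ‖ξ‖ ^ 2) ^ (s / 2) : ℝ) : ℂ))
      (𝓕 (toDistribution (toPhys (ψ + φ)) - u₀)) =
        (((memLp_weighted hs (ψ + φ)).toLp - g : Lp ℂ 2 volume) : 𝓢'(Space d, ℂ)) := by
    rw [← Lp.toTemperedDistributionCLM_apply, map_sub, ← FourierTransform.fourierCLM_apply (R := ℂ),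
      map_sub, map_sub, FourierTransform.fourierCLM_apply, FourierTransform.fourierCLM_apply, hrep,
      hg]
    rfl
  rw [sobolevNorm_eq_enorm hfin, Lp.enorm_def]
  calc eLpNorm (((memLp_weighted hs (ψ + φ)).toLp - g : Lp ℂ 2 volume) : Space d → ℂ) 2 volume
      = eLpNorm ((h - (g : Space d → ℂ)) + weighted s φ) 2 volume := by
        refine eLpNorm_congr_ae ?_
        filter_upwards [Lp.coeFn_sub (memLp_weighted hs (ψ + φ)).toLp g,
          (memLp_weighted hs (ψ + φ)).coeFn_toLp] with ξ h₁ h₂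
        rw [h₁, Pi.sub_apply, h₂, weighted_add, hψh]
        simp only [Pi.add_apply, Pi.sub_apply]
        ring
    _ ≤ eLpNorm (h - (g : Space d → ℂ)) 2 volume + eLpNorm (weighted s φ) 2 volume :=
        eLpNorm_add_le (hcont.aestronglyMeasurable.sub (Lp.aestronglyMeasurable g))
          (continuous_weighted s φ).aestronglyMeasurable (by norm_num)
    _ ≤ _ := by
        rw [eLpNorm_sub_comm]
        gcongr

/-! ### Reduction to a choice of parameters -/

/-- Norm inflation for data that allow a choice of the parameters `N`, `A`, `R`. -/
theorem normInflationAt_of_parameters {s μ : ℝ} (hs : s ≤ 0) (hμ : |μ| = 1)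
    {u₀ : 𝓢'(Space (d + 1), ℂ)} (hu₀ : MemSobolev s 2 u₀)
    (hpar : ∀ δ κ P ε : ℝ, 0 < δ → 0 < κ → 0 ≤ P → 0 < ε → ∃ N A R : ℝ, 1 ≤ A ∧ 4 * A ≤ N ∧ 0 < R ∧
      R * A ^ (d + 1) ≤ N ∧ P ≤ δ * (R * A ^ (d + 1)) ∧ δ / N ^ 4 < ε ∧
      2 * R * (N / 2) ^ s * √(2 * (A ^ (d + 1) * ballVol (d + 1))) < ε ∧
      1 / ε < κ * (R * A ^ (d + 1) / N) ^ 4 * R * √(lowMass (d + 1) s (A / 2))) :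
    NormInflationAt μ s u₀ := by
  intro ε hε
  obtain ⟨δ, κ, hδ, hκ, hgrowth⟩ := exists_growth (d + 1)
  obtain ⟨ψ, hψ⟩ := exists_approx hs hu₀ (ε := ε / 2) (by positivity)
  have hQ : 0 < 1 / ε + 2 * ‖ψ‖ := by positivity
  -- Half of ε is spent on approximating u₀, and 2‖ψ‖ is reserved for the background b(T). This is
  -- possible because ψ is fixed before N, A, R.
  obtain ⟨ε', hε', hε'₁, hε'₂⟩ : ∃ ε' : ℝ, 0 < ε' ∧ ε' ≤ ε / 2 ∧ 1 / ε + 2 * ‖ψ‖ ≤ 1 / ε' := by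
    refine ⟨min (ε / 2) (1 / (1 / ε + 2 * ‖ψ‖)), lt_min (by positivity) (by positivity),
      min_le_left _ _, ?_⟩
    rw [le_div_iff₀ (lt_min (by positivity) (by positivity)), mul_comm, ← le_div_iff₀ hQ]
    exact min_le_right _ _
  obtain ⟨N, A, R, hA₁, hAN, hR, hXN, hP, hT, hdata, hlow⟩ :=
    hpar δ κ ‖ψ‖ ε' hδ hκ (norm_nonneg _) hε'
  have hA : 0 < A := by linarith
  have hN : 0 < N := by linarith
  set η : Space (d + 1) := EuclideanSpace.single 0 N with hη
  have hηN : ‖η‖ = N := by rw [hη]; simp [abs_of_pos hN]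
  obtain ⟨w, b, hw0, hw, hbsup, hbl1, hdiff⟩ :=
    hgrowth μ hμ N A R hA η ψ hηN hA₁ hAN hR hXN hP
  set T := δ / N ^ 4 with hTdef
  have hTpos : 0 < T := by positivity
  refine ⟨T, hTpos, solution w, isSolution_solution hs hw, ?_, T, ⟨hTpos, by linarith⟩, le_rfl, ?_⟩
  · rw [solution, evol_zero, hw0]
    refine (hψ _).trans_lt ?_
    calc _ ≤ ENNReal.ofReal (ε / 2) + ENNReal.ofReal
          (2 * R * (N / 2) ^ s * √(2 * (A ^ (d + 1) * ballVol (d + 1)))) := by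
          gcongr
          exact eLpNorm_weighted_twoTents_le hs hR.le hA hAN hηN
      _ < ENNReal.ofReal ε := by
          rw [← ENNReal.ofReal_add (by positivity) (by positivity)]
          exact (ENNReal.ofReal_lt_ofReal_iff hε).2 (by linarith)
  · rw [solution, sobolevNorm_toPhys hs, eLpNorm_weighted_evol]
    have h₁ : ENNReal.ofReal (κ * (R * A ^ (d + 1) / N) ^ 4 * R * √(lowMass (d + 1) s (A / 2))) ≤
        eLpNorm (weighted s (w T - b T)) 2 volume :=
      le_eLpNorm_weighted s (by positivity) hdiff
    have h₂ : eLpNorm (weighted s (w T - b T)) 2 volume ≤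
        eLpNorm (weighted s (w T)) 2 volume + ENNReal.ofReal (2 * ‖ψ‖) := by
      have e : weighted s (w T - b T) = weighted s (w T) - weighted s (b T) := by
        ext ξ; simp [weighted, mul_sub]
      rw [e]
      refine (eLpNorm_sub_le (continuous_weighted s _).aestronglyMeasurable
        (continuous_weighted s _).aestronglyMeasurable (by norm_num)).trans ?_
      gcongr
      refine (eLpNorm_weighted_le hs (b T)).trans (ENNReal.ofReal_le_ofReal ?_)
      exact max_le hbsup hbl1
    by_contra hcon
    rw [not_lt] at hcon
    have h₃ := (h₁.trans h₂).trans (add_le_add_left hcon _)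
    rw [← ENNReal.ofReal_add (by positivity) (by positivity),
      ENNReal.ofReal_le_ofReal_iff (by positivity)] at h₃
    linarith


/-! ### The choice of the parameters -/

theorem weight_sq (d : ℕ) (s : ℝ) (ξ : Space d) : weight s ξ ^ 2 = (1 + ‖ξ‖ ^ 2) ^ s := by
  rw [weight, ← Real.rpow_natCast, ← Real.rpow_mul (by positivity)]
  congr 1
  push_cast
  ring

theorem le_weight_sq {d : ℕ} {s r : ℝ} (hs : s ≤ 0) (hr : 1 ≤ r) {ξ : Space d} (hξ : ‖ξ‖ ≤ r) :
    (2 * r ^ 2) ^ s ≤ weight s ξ ^ 2 := by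
  rw [weight_sq]
  refine Real.rpow_le_rpow_of_nonpos (by positivity) ?_ hs
  nlinarith [norm_nonneg ξ]

/-- The weight is replaced by a lower bound valid on the whole ball. This misses the logarithm at 2s
+ d = 0, hence the separate critical case. -/
theorem le_lowMass (d : ℕ) {s r : ℝ} (hs : s ≤ 0) (hr : 1 ≤ r) :
    2 ^ s * ballVol d * r ^ (2 * s + d) ≤ lowMass d s r := by
  have hr₀ : 0 < r := by linarith
  have h : ∫ _ in Metric.ball (0 : Space d) r, (2 * r ^ 2) ^ s ≤ lowMass d s r :=
    setIntegral_mono_on (integrableOn_const measure_ball_lt_top.ne) (integrableOn_weight_sq s 0 r)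
      measurableSet_ball fun ξ hξ ↦ le_weight_sq hs hr (by
        rw [Metric.mem_ball, dist_zero_right] at hξ; exact hξ.le)
  refine le_of_eq_of_le ?_ h
  rw [setIntegral_const, volume_real_ball _ hr₀, smul_eq_mul, Real.mul_rpow (by norm_num)
    (by positivity), Real.rpow_add hr₀, Real.rpow_natCast, ← Real.rpow_natCast r 2,
    ← Real.rpow_mul hr₀.le]
  push_cast
  ring

/-- The parameters in the scaling subcritical case. -/
theorem exists_parameters_of_lt {n : ℕ} (hn : 0 < n) {s : ℝ} (hs : s < 0) (hs' : s < n / 2 - 1)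
    {δ κ P ε : ℝ} (hδ : 0 < δ) (hκ : 0 < κ) (hε : 0 < ε) : ∃ N A R : ℝ, 1 ≤ A ∧
      4 * A ≤ N ∧ 0 < R ∧ R * A ^ n ≤ N ∧ P ≤ δ * (R * A ^ n) ∧ δ / N ^ 4 < ε ∧
      2 * R * (N / 2) ^ s * √(2 * (A ^ n * ballVol n)) < ε ∧
      1 / ε < κ * (R * A ^ n / N) ^ 4 * R * √(lowMass n s (A / 2)) := by
  have hv := ballVol_pos (d := n)
  have hn' : (0 : ℝ) < n := by exact_mod_cast hn
  have hq : 0 < (n : ℝ) / 2 - s := by linarith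
  -- With A = N^a and R = N^(1−an), the data have size N^(1+s−an/2) and the output N^(1−a(n/2−s)).
  -- The bounds on a say that the first exponent is negative and the second positive; they are
  -- compatible because s(n/2 − 1 − s) < 0.
  obtain ⟨a, ha₁, ha₂⟩ : ∃ a : ℝ, max 0 ((1 + s) / (n / 2)) < a ∧ a < 1 / (n / 2 - s) := by
    refine exists_between (max_lt (by positivity) ?_)
    rw [div_lt_div_iff₀ (by positivity) hq]
    nlinarith
  have ha₀ : 0 < a := (le_max_left _ _).trans_lt ha₁
  have ha₃ : 1 + s < a * (n / 2) := by
    have := (le_max_right _ _).trans_lt ha₁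
    rwa [div_lt_iff₀ (by positivity)] at this
  have ha₄ : a * (n / 2 - s) < 1 := by rwa [lt_div_iff₀ hq] at ha₂
  -- Here n/2 − s > 1 enters; a < 1 is what allows 4A ≤ N.
  have ha₅ : a < 1 := by nlinarith
  set c₁ := 2 * (1 / 2 : ℝ) ^ s * √(2 * ballVol n) with hc₁
  set c₂ := κ * √(2 ^ s * ballVol n * (1 / 2) ^ (2 * s + n)) with hc₂
  have hc₂pos : 0 < c₂ := by positivity
  have t₁ : Tendsto (fun N : ℝ ↦ c₁ * N ^ (-(a * (n / 2) - (1 + s)))) atTop (𝓝 0) := by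
    simpa using (tendsto_rpow_neg_atTop (by linarith : 0 < a * (n / 2) - (1 + s))).const_mul c₁
  have t₂ : Tendsto (fun N : ℝ ↦ c₂ * N ^ (1 - a * (n / 2 - s))) atTop atTop :=
    (tendsto_rpow_atTop (by linarith)).const_mul_atTop hc₂pos
  have t₃ : Tendsto (fun N : ℝ ↦ N ^ a) atTop atTop := tendsto_rpow_atTop ha₀
  have t₄ : Tendsto (fun N : ℝ ↦ N ^ (1 - a)) atTop atTop := tendsto_rpow_atTop (by linarith)
  have t₅ : Tendsto (fun N : ℝ ↦ δ / N ^ 4) atTop (𝓝 0) :=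
    tendsto_const_nhds.div_atTop (tendsto_pow_atTop (by norm_num))
  have t₆ : Tendsto (fun N : ℝ ↦ δ * N) atTop atTop := tendsto_id.const_mul_atTop hδ
  obtain ⟨N, hN, e₁, e₂, e₃, e₄, e₅, e₆⟩ := ((eventually_gt_atTop (0 : ℝ)).and
    ((t₁.eventually_lt_const hε).and ((t₂.eventually_gt_atTop (1 / ε)).and
      ((t₃.eventually_ge_atTop 2).and ((t₄.eventually_ge_atTop 4).and
        ((t₅.eventually_lt_const hε).and (t₆.eventually_ge_atTop P))))))).exists
  have hAn : (N ^ a) ^ n = N ^ (a * n) := by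
    rw [← Real.rpow_natCast, ← Real.rpow_mul hN.le]
  have hX : N ^ (1 - a * n) * (N ^ a) ^ n = N := by
    rw [hAn, ← Real.rpow_add hN, sub_add_cancel, Real.rpow_one]
  -- R A^n = N is the largest admissible value and removes the factor (R A^n / N)⁴.
  refine ⟨N, N ^ a, N ^ (1 - a * n), by linarith, ?_, by positivity, hX.le, by rwa [hX], e₅, ?_, ?_⟩
  · calc 4 * N ^ a ≤ N ^ (1 - a) * N ^ a := by gcongr
      _ = N := by rw [← Real.rpow_add hN, sub_add_cancel, Real.rpow_one]
  · refine lt_of_eq_of_lt ?_ e₁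
    rw [hAn, hc₁, show 2 * (N ^ (a * n) * ballVol n) = 2 * ballVol n * N ^ (a * n) by ring,
      Real.sqrt_mul (by positivity), Real.sqrt_eq_rpow (N ^ (a * n)), ← Real.rpow_mul hN.le,
      show N / 2 = 1 / 2 * N by ring, Real.mul_rpow (by norm_num) hN.le,
      show -(a * (n / 2) - (1 + s)) = (1 - a * n) + s + a * n * (1 / 2) by ring,
      Real.rpow_add hN, Real.rpow_add hN]
    ring
  · refine e₂.trans_le ?_
    rw [hX, div_self hN.ne', one_pow, mul_one]
    have h := Real.sqrt_le_sqrt (le_lowMass n hs.le (by linarith : 1 ≤ N ^ a / 2))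
    refine le_trans (le_of_eq ?_) (mul_le_mul_of_nonneg_left h (by positivity))
    rw [show N ^ a / 2 = 1 / 2 * N ^ a by ring, Real.mul_rpow (by norm_num) (by positivity),
      ← mul_assoc, Real.sqrt_mul (by positivity), Real.sqrt_eq_rpow ((N ^ a) ^ (2 * s + (n : ℝ))),
      ← Real.rpow_mul hN.le, ← Real.rpow_mul hN.le, hc₂,
      show 1 - a * (n / 2 - s) = (1 - a * n) + a * (2 * s + n) * (1 / 2) by ring, Real.rpow_add hN]
    ring

/-! ### Low-frequency mass in the critical case -/

theorem lowMass_mono (d : ℕ) (s : ℝ) : Monotone (lowMass d s) := fun _ r' h ↦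
  setIntegral_mono_set (integrableOn_weight_sq s 0 r') (Eventually.of_forall fun _ ↦ sq_nonneg _)
    (Metric.ball_subset_ball h).eventuallyLE

theorem lowMass_le {d : ℕ} {s r : ℝ} (hs : s ≤ 0) (hr : 0 < r) :
    lowMass d s r ≤ r ^ d * ballVol d := by
  have h : lowMass d s r ≤ ∫ _ in Metric.ball (0 : Space d) r, (1 : ℝ) :=
    setIntegral_mono_on (integrableOn_weight_sq s 0 r) (integrableOn_const measure_ball_lt_top.ne)
      measurableSet_ball fun ξ _ ↦ pow_le_one₀ (weight_pos s ξ).le (weight_le_one hs ξ)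
  rwa [setIntegral_const, volume_real_ball _ hr, smul_eq_mul, mul_one] at h

/-- In the critical case each dyadic annulus carries the same amount of mass. -/
theorem lowMass_double_ge {r : ℝ} (hr : 1 ≤ r) :
    lowMass 1 (-(1 / 2)) r + ballVol 1 / 4 ≤ lowMass 1 (-(1 / 2)) (2 * r) := by
  have hr₀ : 0 < r := by linarith
  have hv := ballVol_pos (d := 1)
  have hsub : Metric.ball (0 : Space 1) r ⊆ Metric.ball 0 (2 * r) :=
    Metric.ball_subset_ball (by linarith)
  have hdiff : lowMass 1 (-(1 / 2)) (2 * r) - lowMass 1 (-(1 / 2)) r =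
      ∫ ξ in Metric.ball (0 : Space 1) (2 * r) \ Metric.ball 0 r, weight (-(1 / 2)) ξ ^ 2 :=
    (setIntegral_sdiff measurableSet_ball (integrableOn_weight_sq _ _ _) hsub).symm
  have hvol : volume.real (Metric.ball (0 : Space 1) (2 * r) \ Metric.ball 0 r) =
      r * ballVol 1 := by
    rw [measureReal_sdiff hsub measurableSet_ball, volume_real_ball _ hr₀,
      volume_real_ball _ (by positivity)]
    ring
  have h : ∫ _ in Metric.ball (0 : Space 1) (2 * r) \ Metric.ball 0 r,
      (2 * (2 * r) ^ 2) ^ (-(1 / 2) : ℝ) ≤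
      ∫ ξ in Metric.ball (0 : Space 1) (2 * r) \ Metric.ball 0 r, weight (-(1 / 2)) ξ ^ 2 :=
    setIntegral_mono_on (integrableOn_const
      ((measure_mono sdiff_subset).trans_lt measure_ball_lt_top).ne)
      ((integrableOn_weight_sq _ _ _).mono_set sdiff_subset)
      (measurableSet_ball.diff measurableSet_ball) fun ξ hξ ↦
        le_weight_sq (by norm_num) (by linarith) (by
          have := hξ.1
          rw [Metric.mem_ball, dist_zero_right] at this; exact this.le)
  rw [setIntegral_const, hvol, smul_eq_mul, ← hdiff] at h
  have h₁ : 1 / (4 * r) ≤ (2 * (2 * r) ^ 2) ^ (-(1 / 2) : ℝ) := by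
    rw [Real.rpow_neg (by positivity), ← Real.sqrt_eq_rpow, ← one_div]
    refine one_div_le_one_div_of_le (by positivity) (Real.sqrt_le_iff.2 ⟨by positivity, ?_⟩)
    nlinarith [sq_nonneg r]
  have h₂ : ballVol 1 / 4 ≤ r * ballVol 1 * (2 * (2 * r) ^ 2) ^ (-(1 / 2) : ℝ) := by
    refine le_trans (le_of_eq ?_) (mul_le_mul_of_nonneg_left h₁ (by positivity))
    field_simp
  linarith

/-- Each doubling of the radius adds a fixed amount, so the mass grows at least logarithmically. -/
theorem tendsto_lowMass_atTop : Tendsto (lowMass 1 (-(1 / 2))) atTop atTop := by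
  have hv := ballVol_pos (d := 1)
  have h : ∀ k : ℕ, k * (ballVol 1 / 4) ≤ lowMass 1 (-(1 / 2)) (2 ^ k) := by
    intro k
    induction k with
    | zero => simpa using lowMass_nonneg (d := 1) (-(1 / 2)) 1
    | succ k ih =>
      have := lowMass_double_ge (r := 2 ^ k) (one_le_pow₀ (by norm_num))
      rw [← pow_succ'] at this
      push_cast
      linarith
  refine tendsto_atTop_atTop_of_monotone (lowMass_mono _ _) fun c ↦ ?_
  obtain ⟨k, hk⟩ := exists_nat_ge (c / (ballVol 1 / 4))
  refine ⟨2 ^ k, le_trans ?_ (h k)⟩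
  rwa [div_le_iff₀ (by positivity)] at hk

/-- The parameters in the scaling critical case in one dimension. -/
theorem exists_parameters_critical {δ κ P ε : ℝ} (hδ : 0 < δ) (hκ : 0 < κ) (hε : 0 < ε) :
    ∃ N A R : ℝ, 1 ≤ A ∧ 4 * A ≤ N ∧ 0 < R ∧ R * A ^ 1 ≤ N ∧ P ≤ δ * (R * A ^ 1) ∧ δ / N ^ 4 < ε ∧
      2 * R * (N / 2) ^ (-(1 / 2) : ℝ) * √(2 * (A ^ 1 * ballVol 1)) < ε ∧
      1 / ε < κ * (R * A ^ 1 / N) ^ 4 * R * √(lowMass 1 (-(1 / 2)) (A / 2)) := by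
  have hv := ballVol_pos (d := 1)
  have tj : Tendsto (fun A : ℝ ↦ lowMass 1 (-(1 / 2)) (A / 2)) atTop atTop :=
    tendsto_lowMass_atTop.comp (tendsto_id.atTop_div_const (by norm_num))
  have t₁ : Tendsto (fun A : ℝ ↦ 2 * √(ballVol 1) *
      lowMass 1 (-(1 / 2)) (A / 2) ^ (-(1 / 20) : ℝ)) atTop (𝓝 0) := by
    simpa using ((tendsto_rpow_neg_atTop (by norm_num : (0 : ℝ) < 1 / 20)).comp tj).const_mul
      (2 * √(ballVol 1))
  have t₂ : Tendsto (fun A : ℝ ↦ κ * (1 / 4) ^ 4 *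
      lowMass 1 (-(1 / 2)) (A / 2) ^ (1 / 4 : ℝ)) atTop atTop :=
    ((tendsto_rpow_atTop (by norm_num)).comp tj).const_mul_atTop (by positivity)
  have t₃ : Tendsto (fun A : ℝ ↦ δ * (√(ballVol 1 / 2))⁻¹ * √A) atTop atTop :=
    (Real.tendsto_sqrt_atTop).const_mul_atTop (by positivity)
  have t₄ : Tendsto (fun A : ℝ ↦ δ / (4 * A) ^ 4) atTop (𝓝 0) :=
    tendsto_const_nhds.div_atTop
      ((tendsto_pow_atTop (by norm_num)).comp (tendsto_id.const_mul_atTop (by norm_num)))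
  obtain ⟨A, hA, ej, e₁, e₂, e₃, e₄⟩ := ((eventually_ge_atTop (1 : ℝ)).and
    ((tj.eventually_ge_atTop 1).and ((t₁.eventually_lt_const hε).and
      ((t₂.eventually_gt_atTop (1 / ε)).and ((t₃.eventually_ge_atTop P).and
        (t₄.eventually_lt_const hε)))))).exists
  have hA₀ : 0 < A := by linarith
  set j := lowMass 1 (-(1 / 2)) (A / 2) with hj
  have hj₀ : 0 < j := by linarith
  -- The data have size comparable to R and the output to R⁵ j^(1/2), so any exponent strictly
  -- between −1/10 and 0 works. This one gives j^(1/4).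
  set R := j ^ (-(1 / 20) : ℝ) with hR
  have hR₀ : 0 < R := by positivity
  have hR₁ : R ≤ 1 := Real.rpow_le_one_of_one_le_of_nonpos ej (by norm_num)
  -- N = 4A is the smallest admissible frequency, so R A / N loses only the constant 1/4 against R.
  refine ⟨4 * A, A, R, hA, le_rfl, hR₀, ?_, e₃.trans ?_, e₄, lt_of_eq_of_lt ?_ e₁,
    e₂.trans_eq ?_⟩
  · rw [pow_one]; nlinarith
  · rw [pow_one, mul_assoc]
    refine mul_le_mul_of_nonneg_left ?_ hδ.le
    -- Since j grows at most linearly in A, R ≥ j^(−1/2) makes R A at least a multiple of √A, which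
    -- outgrows P.
    have hjA : j ≤ ballVol 1 / 2 * A := by
      have := lowMass_le (d := 1) (s := -(1 / 2)) (by norm_num) (by positivity : 0 < A / 2)
      rw [pow_one] at this
      linarith
    have hRj : (√j)⁻¹ ≤ R := by
      rw [hR, Real.sqrt_eq_rpow, ← Real.rpow_neg hj₀.le]
      exact Real.rpow_le_rpow_of_exponent_le ej (by norm_num)
    have h₁ : (√(ballVol 1 / 2) * √A)⁻¹ ≤ (√j)⁻¹ := by
      rw [← Real.sqrt_mul (by positivity)]
      exact inv_anti₀ (by positivity) (Real.sqrt_le_sqrt hjA)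
    have hs : √A * √A = A := Real.mul_self_sqrt hA₀.le
    have hsp : 0 < √A := by positivity
    calc (√(ballVol 1 / 2))⁻¹ * √A = (√(ballVol 1 / 2) * √A)⁻¹ * A := by
          rw [mul_inv]; nth_rw 3 [← hs]; field_simp
      _ ≤ R * A := mul_le_mul_of_nonneg_right (h₁.trans hRj) hA₀.le
  · rw [pow_one, show 4 * A / 2 = 2 * A by ring, Real.rpow_neg (by positivity),
      ← Real.sqrt_eq_rpow, show 2 * (A * ballVol 1) = 2 * A * ballVol 1 by ring,
      Real.sqrt_mul (by positivity : (0 : ℝ) ≤ 2 * A) (ballVol 1)]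
    have h : √(2 * A) ≠ 0 := by positivity
    calc 2 * R * (√(2 * A))⁻¹ * (√(2 * A) * √(ballVol 1)) =
        2 * √(ballVol 1) * R * ((√(2 * A))⁻¹ * √(2 * A)) := by ring
      _ = _ := by rw [inv_mul_cancel₀ h, mul_one]
  · rw [pow_one, show R * A / (4 * A) = 1 / 4 * R by field_simp, mul_pow, Real.sqrt_eq_rpow]
    have h : R ^ 4 * R * j ^ (1 / 2 : ℝ) = j ^ (1 / 4 : ℝ) := by
      rw [← pow_succ, hR, ← Real.rpow_natCast, ← Real.rpow_mul hj₀.le, ← Real.rpow_add hj₀]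
      norm_num
    rw [← h]
    ring

end FreqSpace
end QuinticFourthOrderNLS

/-! ### The theorem -/

theorem theorem1p1 (d : ℕ) (hd : 1 ≤ d) (s : ℝ) (hs₁ : d = 1 → s ≤ -(1 / 2))
    (hs₂ : 2 ≤ d → s < 0) (μ : ℝ) (hμ : μ = 1 ∨ μ = -1)
    (u₀ : 𝓢'(EuclideanSpace ℝ (Fin d), ℂ)) (hu₀ : MemSobolev s 2 u₀) :
    QuinticFourthOrderNLS.NormInflationAt μ s u₀ := by
  have hμ' : |μ| = 1 := by rcases hμ with rfl | rfl <;> simp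
  obtain ⟨n, rfl⟩ : ∃ n, d = n + 1 := ⟨d - 1, by omega⟩
  have hs : s < 0 := by
    rcases Nat.eq_zero_or_pos n with rfl | hn
    · have := hs₁ rfl; linarith
    · exact hs₂ (by omega)
  refine QuinticFourthOrderNLS.FreqSpace.normInflationAt_of_parameters hs.le hμ' hu₀ fun δ κ P ε hδ hκ _ hε ↦ ?_
  -- The exponent d/2 − 1 equals −1/2 for d = 1, where the endpoint is allowed. It is nonnegative
  -- for d ≥ 2, so there s < 0 is strictly below it.
  rcases Nat.eq_zero_or_pos n with rfl | hn
  · rcases (hs₁ rfl).lt_or_eq with h | rfl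
    · exact QuinticFourthOrderNLS.FreqSpace.exists_parameters_of_lt one_pos hs (by norm_num at h ⊢; linarith) hδ hκ hε
    · exact QuinticFourthOrderNLS.FreqSpace.exists_parameters_critical hδ hκ hε
  · refine QuinticFourthOrderNLS.FreqSpace.exists_parameters_of_lt n.succ_pos hs ?_ hδ hκ hε
    have : (1 : ℝ) ≤ n := by exact_mod_cast hn
    push_cast
    linarith
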